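/- **Conventions.** A *circulation* on a topological space $X$ assigns to each open $U\subseteq X$ a preorder $\leqslant_U$ on $U$ such that, for every collection $\mathcal O$ of open subsets of $X$, $\leqslant_{\bigcup\mathcal O}$ is the preorder on $\bigcup\mathcal O$ with smallest graph containing the graph of $\leqslant_U$ for each $U\in\mathcal O$. Spaces with circulations form a category whose morphisms, the *stream maps*, are the continuous maps $f:X\to Y$ with $f(x)\leqslant_U f(y)$ whenever $x\leqslant_{f^{-1}U}y$. Let $\mathscr U$ be its full subcategory on those objects that are colimits in it of objects with compact Hausdorff underlying spaces and that are weak Hausdorff (continuous images of compact Hausdorff spaces in them are Hausdorff). Objects of $\mathscr U$ are called *streams*. Let $\mathscr G$ be a small category; a *$\mathscr G$-stream* is a functor $\mathscr G\to\mathscr U$, and a *$\mathscr G$-stream map* is a natural transformation of such functors. Let $\mathbb I$ be the unit interval $[0,1]$ with the initial circulation ($x\leqslant_U y$ iff $x=y\in U$), regarded as a constant $\mathscr G$-stream; the same applies to $\{0\}$. Let $E^{\mathbb I}$ denote the exponential in the Cartesian closed category $\mathscr U^{\mathscr G}$ (the value at $E$ of the right adjoint of $-\times\mathbb I$). For $\mathscr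 G$-stream maps $f,g:Y\to Z$, write $h:f\sim g$ for a $\mathscr G$-stream map $h:Y\times\mathbb I\to Z$ restricting to $f$ on $Y\times\{0\}$ and to $g$ on $Y\times\{1\}$, and $f\sim g$ if such an $h$ exists. For $e:X\to Y$, $f\sim g$ *relative $e$* means that $fe=ge$ and some $h:f\sim g$ satisfies $h(e\times\mathbb I)=fe\,\pi_X$, where $\pi_X:X\times\mathbb I\to X$ is the projection. A $\mathscr G$-stream map $f:X\to Y$ is *h-acyclic* if there is a $\mathscr G$-stream map $g:Y\to X$ with $gf\sim 1_X$ and $fg\sim 1_Y$. It is an *h-fibration* if it has the right lifting property against $A\times(\{0\}\hookrightarrow\mathbb I)$ for each $\mathscr G$-stream $A$, and an *h-cofibration* if it has the left lifting property against $E^{\{0\}\hookrightarrow\mathbb I}:E^{\mathbb I}\to E$ for each $\mathscr G$-stream $E$. **Theorem.** The following are equivalent for a $\mathscr G$-stream map $e:X\to Y$. 1. $e$ has the left lifting property against all h-acyclic h-fibrations. 2. $e$ is an h-cofibration. 3. There exist a $\mathscr G$-stream map $u:Y\to\mathbb I$ such that the square with sides $e:X\to Y$, $X\to\{0\}$, $u:Y\to\mathbb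 I$ and $\{0\}\hookrightarrow\mathbb I$ is a pullback square in $\mathscr U^{\mathscr G}$, and a $\mathscr G$-stream map $f:Y\to Y$ with $f\sim 1_Y$ relative $e$, such that for each object $o$ of $\mathscr G$ and each $y\in Y(o)$, if $u_o(y)<1$ then $f_o(y)$ lies in the image of $e_o:X(o)\to Y(o)$. -/

import Mathlib

open CategoryTheory CategoryTheory.Limits TopologicalSpace

universe u v

/-! ### Circulations and streams on arbitrary topological spaces -/

/-- A circulation on a space `X`: to each open `U` a preorder `≤_U` on `U` (encoded as a relation on
`X` supported on `U`), sending the union of a collection `𝒪` of open sets to the smallest preorder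
on that union whose graph contains the graph of `≤_U` for every `U ∈ 𝒪`. -/
structure Circulation (X : Type u) [TopologicalSpace X] where
  /-- `le U x y` means `x ≤_U y`. -/
  le : Opens X → X → X → Prop
  mem : ∀ {U x y}, le U x y → x ∈ U ∧ y ∈ U
  refl : ∀ {U x}, x ∈ U → le U x x
  trans : ∀ {U x y z}, le U x y → le U y z → le U x z
  cosheaf : ∀ (𝒪 : Set (Opens X)) (x y : X), le (sSup 𝒪) x y ↔
    x ∈ sSup 𝒪 ∧ Relation.ReflTransGen (fun a b => ∃ U ∈ 𝒪, le U a b) x y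

namespace Circulation

variable {X : Type u} [TopologicalSpace X]

theorem mono (c : Circulation X) {U V : Opens X} (h : U ≤ V) {x y : X} (hxy : c.le U x y) :
    c.le V x y := by
  have hV : sSup {U, V} = V := by rw [sSup_pair]; exact sup_eq_right.2 h
  rw [← hV, c.cosheaf]
  refine ⟨?_, .single ⟨U, by simp, hxy⟩⟩
  rw [hV]
  exact h (c.mem hxy).1

theorem comap_sSup {Y : Type v} [TopologicalSpace Y] (c : Circulation X) (f : C(X, Y))
    (𝒪 : Set (Opens Y)) (x y : X) : c.le ((sSup 𝒪).comap f) x y ↔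
      f x ∈ sSup 𝒪 ∧ Relation.ReflTransGen (fun a b => ∃ U ∈ 𝒪, c.le (U.comap f) a b) x y := by
  have h : (sSup 𝒪).comap f = sSup ((fun U : Opens Y => U.comap f) '' 𝒪) := by
    ext z; simp
  have h2 : f x ∈ sSup 𝒪 ↔ x ∈ (sSup 𝒪).comap f := Iff.rfl
  rw [h2, h, c.cosheaf]
  simp only [Set.exists_mem_image]

/-- The initial circulation: `x ≤_U y` if and only if `x = y ∈ U`. -/
def initial (X : Type u) [TopologicalSpace X] : Circulation X where
  le U x y := x = y ∧ x ∈ U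
  mem := by rintro U x y ⟨rfl, h⟩; exact ⟨h, h⟩
  refl h := ⟨rfl, h⟩
  trans := by rintro U x y z ⟨rfl, h⟩ ⟨rfl, _⟩; exact ⟨rfl, h⟩
  cosheaf 𝒪 x y := by
    constructor
    · rintro ⟨rfl, h⟩
      exact ⟨h, .refl⟩
    · rintro ⟨h, hr⟩
      refine ⟨?_, h⟩
      induction hr with
      | refl => rfl
      | tail _ hs ih =>
        obtain ⟨_, _, he, _⟩ := hs
        exact ih.trans he

end Circulation

/-- A topological space together with a circulation on it. -/
structure CircSpace : Type (u + 1) where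
  carrier : Type u
  [top : TopologicalSpace carrier]
  circ : Circulation carrier

namespace CircSpace

instance : CoeSort CircSpace.{u} (Type u) := ⟨CircSpace.carrier⟩

instance (X : CircSpace.{u}) : TopologicalSpace X := X.top

/-- Stream maps: continuous maps `f` with `f x ≤_U f y` whenever `x ≤_{f⁻¹ U} y`. -/
@[ext]
structure Hom (X Y : CircSpace.{u}) where
  map : C(X, Y)
  mono : ∀ (U : Opens Y) (x y : X), X.circ.le (U.comap map) x y → Y.circ.le U (map x) (map y)

instance : Category CircSpace.{u} where
  Hom X Y := Hom X Y
  id X := ⟨ContinuousMap.id X, fun _ _ _ h => h⟩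
  comp f g := ⟨g.map.comp f.map, fun U x y h => g.mono U _ _ (f.mono _ x y h)⟩

@[ext]
theorem hom_ext {X Y : CircSpace.{u}} {f g : X ⟶ Y} (h : ∀ x, f.map x = g.map x) : f = g :=
  Hom.ext (ContinuousMap.ext h)

@[simp] theorem id_map {X : CircSpace.{u}} (x : X) : Hom.map (𝟙 X) x = x := rfl

@[simp] theorem comp_map {X Y Z : CircSpace.{u}} (f : X ⟶ Y) (g : Y ⟶ Z) (x : X) :
    (f ≫ g).map x = g.map (f.map x) := rfl

/-- A space regarded as a stream with the initial circulation. -/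
def ofSpace (X : Type u) [TopologicalSpace X] : CircSpace.{u} := ⟨X, Circulation.initial X⟩

/-- Continuous maps are stream maps out of an initial circulation. -/
def ofSpaceHom {X : Type u} [TopologicalSpace X] {Y : CircSpace.{u}} (f : C(X, Y)) :
    ofSpace X ⟶ Y :=
  ⟨f, by rintro U x y ⟨rfl, h⟩; exact Y.circ.refl h⟩

/-- The stream has a compact Hausdorff underlying space. -/
def IsCompactHausdorff : ObjectProperty CircSpace.{u} := fun X => CompactSpace X ∧ T2Space X

/-- k-streams: colimits, in the category of all streams and stream maps, of compact Hausdorff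
streams. -/
def IsKStream : ObjectProperty CircSpace.{u} := fun X =>
  ∃ (J : Type u) (_ : SmallCategory J), IsCompactHausdorff.{u}.colimitsOfShape J X

/-- Weak Hausdorff: continuous images of compact Hausdorff spaces are Hausdorff. -/
def IsWeakHausdorff : ObjectProperty CircSpace.{u} := fun X =>
  ∀ (K : Type u) [TopologicalSpace K] [CompactSpace K] [T2Space K] (φ : C(K, X)),
    T2Space (Set.range φ)

/-! ### Final structures -/

/-- The circulation generated by a family of maps out of streams: the smallest one making all of
them stream maps. -/
def finalCirc {X : Type u} [TopologicalSpace X] {ι : Type v} (K : ι → CircSpace.{u})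
    (φ : ∀ i, C(K i, X)) : Circulation X where
  le U x y := x ∈ U ∧ Relation.ReflTransGen
    (fun p q => ∃ i a b, (K i).circ.le (U.comap (φ i)) a b ∧ φ i a = p ∧ φ i b = q) x y
  mem := by
    rintro U x y ⟨h, hr⟩
    refine ⟨h, ?_⟩
    cases hr with
    | refl => exact h
    | tail _ hs =>
      obtain ⟨i, a, b, hab, _, rfl⟩ := hs
      exact ((K i).circ.mem hab).2
  refl h := ⟨h, .refl⟩
  trans h h' := ⟨h.1, h.2.trans h'.2⟩
  cosheaf 𝒪 x y := by
    refine and_congr_right fun _ => ⟨fun hr => ?_, fun hr => ?_⟩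
    · induction hr with
      | refl => exact .refl
      | tail _ hs ih =>
        obtain ⟨i, a, b, hab, rfl, rfl⟩ := hs
        refine ih.trans ?_
        rw [(K i).circ.comap_sSup] at hab
        refine hab.2.lift (φ i) ?_
        rintro p q ⟨U, hU, hpq⟩
        exact ⟨U, hU, ((K i).circ.mem hpq).1, .single ⟨i, p, q, hpq, rfl, rfl⟩⟩
    · induction hr with
      | refl => exact .refl
      | tail _ hs ih =>
        obtain ⟨U, hU, _, hr⟩ := hs
        refine ih.trans (Relation.ReflTransGen.mono ?_ _ _ hr)
        rintro p q ⟨i, a, b, hab, hp, hq⟩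
        exact ⟨i, a, b, (K i).circ.mono (fun z hz => le_sSup (a := U) hU hz) hab, hp, hq⟩

/-- The set `X` with the final topology and the final circulation for a family of functions out of
streams. -/
def finalSpace (X : Type u) {ι : Type v} (K : ι → CircSpace.{u}) (φ : ∀ i, K i → X) :
    CircSpace.{u} :=
  letI τ : TopologicalSpace X := ⨆ i, (K i).top.coinduced (φ i)
  { carrier := X
    top := τ
    circ := finalCirc K fun i => ⟨φ i, ⟨fun _ hA => isOpen_iSup_iff.1 hA i⟩⟩ }

section finalSpace

variable {X : Type u} {ι : Type v} {K : ι → CircSpace.{u}} {φ : ∀ i, K i → X}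

theorem isOpen_finalSpace {A : Set (finalSpace X K φ)} :
    IsOpen A ↔ ∀ i, IsOpen ((fun a => φ i a) ⁻¹' A) :=
  isOpen_iSup_iff

/-- The structure maps into a final stream. -/
def finalMap (K : ι → CircSpace.{u}) (φ : ∀ i, K i → X) (i : ι) : K i ⟶ finalSpace X K φ :=
  ⟨⟨φ i, ⟨fun _ hA => isOpen_finalSpace.1 hA i⟩⟩, fun _ a b h =>
    ⟨((K i).circ.mem h).1, .single ⟨i, a, b, h, rfl, rfl⟩⟩⟩

/-- Functions out of a final stream are stream maps as soon as their composites with the structure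
maps are. -/
def finalDesc {Z : CircSpace.{u}} (f : X → Z)
    (h : ∀ i, ∃ g : K i ⟶ Z, ∀ a, g.map a = f (φ i a)) : finalSpace X K φ ⟶ Z where
  map := ⟨f, ⟨fun A hA => isOpen_finalSpace.2 fun i => by
    obtain ⟨g, hg⟩ := h i
    convert hA.preimage g.map.continuous using 1
    ext a
    exact iff_of_eq (congrArg (· ∈ A) (hg a).symm)⟩⟩
  mono := by
    rintro U x y ⟨hx, hr⟩
    change Z.circ.le U (f x) (f y)
    induction hr with
    | refl => exact Z.circ.refl hx
    | tail _ hs ih =>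
      obtain ⟨i, a, b, hab, rfl, rfl⟩ := hs
      obtain ⟨g, hg⟩ := h i
      refine Z.circ.trans ih ?_
      have := g.mono U a b (by
        convert hab using 1
        ext z
        exact iff_of_eq (congrArg (· ∈ U) (hg z)))
      rwa [hg, hg] at this

end finalSpace

/-- The structure of `X` is final with respect to all stream maps from compact Hausdorff streams. -/
def IsCompactlyFinal (X : CircSpace.{u}) : Prop :=
  (∀ A : Set X, (∀ (K : CircSpace.{u}) (φ : K ⟶ X), IsCompactHausdorff K → IsOpen (φ.map ⁻¹' A)) →
    IsOpen A) ∧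
  ∀ (U : Opens X) (x y : X), X.circ.le U x y → Relation.ReflTransGen
    (fun p q => ∃ (K : CircSpace.{u}) (φ : K ⟶ X) (a b : K), IsCompactHausdorff K ∧
      K.circ.le (U.comap φ.map) a b ∧ φ.map a = p ∧ φ.map b = q) x y

theorem IsKStream.isCompactlyFinal {X : CircSpace.{u}} (h : IsKStream X) :
    X.IsCompactlyFinal := by
  obtain ⟨J, _, ⟨P⟩⟩ := h
  let ι := Σ K : { K : CircSpace.{u} // IsCompactHausdorff K }, (K.1 ⟶ X)
  let X' : CircSpace.{u} := finalSpace X (fun i : ι => i.1.1) (fun i => i.2.map)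
  let toX : X' ⟶ X := finalDesc (fun x => x) fun i => ⟨i.2, fun _ => rfl⟩
  let s : Cocone P.diag :=
    { pt := X'
      ι :=
        { app := fun j => finalMap (fun i : ι => i.1.1) (fun i => i.2.map)
            ⟨⟨P.diag.obj j, P.prop_diag_obj j⟩, P.ι.app j⟩
          naturality := fun i j f => by
            apply hom_ext
            intro x
            exact congrArg (fun g : P.diag.obj i ⟶ X => g.map x) (P.ι.naturality f) } }
  have hd : P.isColimit.desc s ≫ toX = 𝟙 X := by
    refine P.isColimit.hom_ext fun j => ?_
    rw [← Category.assoc, P.isColimit.fac]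
    rfl
  have hd' : ∀ x : X, (P.isColimit.desc s).map x = x := fun x =>
    congrArg (fun g : X ⟶ X => g.map x) hd
  constructor
  · intro A hA
    have h1 : IsOpen (X := X') A := isOpen_finalSpace.2 fun i => hA i.1.1 i.2 i.1.2
    have h2 := h1.preimage (P.isColimit.desc s).map.continuous
    convert h2 using 1
    ext x
    exact iff_of_eq (congrArg (· ∈ A) (hd' x).symm)
  · intro U x y hxy
    have hU : IsOpen (X := X') (U : Set X) :=
      isOpen_finalSpace.2 fun i => U.2.preimage i.2.map.continuous
    let U' : Opens X' := ⟨(U : Set X), hU⟩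
    have h1 := (P.isColimit.desc s).mono U' x y (by
      convert hxy using 1
      apply Opens.ext
      ext z
      exact iff_of_eq (congrArg (· ∈ U) (hd' z)))
    rw [hd' x, hd' y] at h1
    refine Relation.ReflTransGen.mono ?_ _ _ h1.2
    rintro p q ⟨i, a, b, hab, hp, hq⟩
    exact ⟨i.1.1, i.2, a, b, i.1.2, hab, hp, hq⟩

theorem IsCompactlyFinal.isKStream {X : CircSpace.{u}} (h : X.IsCompactlyFinal) :
    IsKStream X := by
  classical
  obtain ⟨h1, h2⟩ := h
  -- a small generating family of maps from compact Hausdorff streams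
  let pt : CircSpace.{u} := ofSpace PUnit
  have hpt : IsCompactHausdorff pt := ⟨inferInstanceAs (CompactSpace PUnit),
    inferInstanceAs (T2Space PUnit)⟩
  let ptMap : ∀ x : X, pt ⟶ X := fun x => ofSpaceHom (ContinuousMap.const _ x)
  by_cases hX : IsEmpty X
  · refine ⟨Discrete PEmpty.{u + 1}, inferInstance, ⟨{
      diag := Functor.empty _
      ι := { app := fun j => j.as.elim, naturality := fun i => i.as.elim }
      isColimit := {
        desc := fun s => ⟨⟨fun x => hX.elim x, by
            have : IsEmpty X := hX
            exact continuous_of_discreteTopology⟩, fun U x => hX.elim x⟩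
        fac := fun _ j => j.as.elim
        uniq := fun s m _ => by
          apply hom_ext
          intro x
          exact hX.elim x }
      prop_diag_obj := fun j => j.as.elim }⟩⟩
  obtain ⟨x₀⟩ := not_isEmpty_iff.1 hX
  have e1 : ∀ A : Set X, ∃ (K : CircSpace.{u}) (φ : K ⟶ X), IsCompactHausdorff K ∧
      (IsOpen (φ.map ⁻¹' A) → IsOpen A) := by
    intro A
    by_cases hA : IsOpen A
    · exact ⟨pt, ptMap x₀, hpt, fun _ => hA⟩
    · by_contra hcon
      push Not at hcon
      exact hA (h1 A fun K φ hK => (hcon K φ hK).1)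
  have e2 : ∀ r : Opens X × X × X, ∃ (K : CircSpace.{u}) (φ : K ⟶ X), IsCompactHausdorff K ∧
      ((∃ (K : CircSpace.{u}) (φ : K ⟶ X) (a b : K), IsCompactHausdorff K ∧
        K.circ.le (r.1.comap φ.map) a b ∧ φ.map a = r.2.1 ∧ φ.map b = r.2.2) →
      ∃ a b, K.circ.le (r.1.comap φ.map) a b ∧ φ.map a = r.2.1 ∧ φ.map b = r.2.2) := by
    intro r
    by_cases hr : ∃ (K : CircSpace.{u}) (φ : K ⟶ X) (a b : K), IsCompactHausdorff K ∧
        K.circ.le (r.1.comap φ.map) a b ∧ φ.map a = r.2.1 ∧ φ.map b = r.2.2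
    · obtain ⟨K, φ, a, b, hK, h⟩ := hr
      exact ⟨K, φ, hK, fun _ => ⟨a, b, h⟩⟩
    · exact ⟨pt, ptMap x₀, hpt, fun h => absurd h hr⟩
  choose K1 φ1 hK1 hφ1 using e1
  choose K2 φ2 hK2 hφ2 using e2
  let I := Set X ⊕ (Opens X × X × X) ⊕ X
  let O : I → Over X := Sum.elim (fun A => Over.mk (φ1 A))
    (Sum.elim (fun r => Over.mk (φ2 r)) (fun x => Over.mk (ptMap x)))
  have hO : ∀ i, IsCompactHausdorff (O i).left := by
    rintro (A | r | x)
    · exact hK1 A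
    · exact hK2 r
    · exact hpt
  let J := InducedCategory (Over X) O
  let F : J ⥤ CircSpace.{u} := inducedFunctor O ⋙ Over.forget X
  let c : (j : J) → F.obj j ⟶ X := fun j => (O j).hom
  let ptJ : X → J := fun x => Sum.inr (Sum.inr x)
  have key : ∀ (s : Cocone F) (j : J) (a : F.obj j),
      (s.ι.app (ptJ ((c j).map a))).map PUnit.unit = (s.ι.app j).map a := by
    intro s j a
    let f : ptJ ((c j).map a) ⟶ j := InducedCategory.homMk
      (Over.homMk (ofSpaceHom (ContinuousMap.const _ a)) (by ext z; rfl))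
    exact (congrArg (fun g => Hom.map g PUnit.unit) (s.w f)).symm
  refine ⟨J, inferInstance, ⟨{
    diag := F
    ι := { app := c, naturality := fun i j f => by
            exact (Over.w f.hom).trans (Category.comp_id _).symm }
    isColimit := ?_
    prop_diag_obj := hO }⟩⟩
  refine
    { desc := fun s => ⟨⟨fun x => (s.ι.app (ptJ x)).map PUnit.unit, ⟨fun A hA => ?_⟩⟩, ?_⟩
      fac := fun s j => ?_
      uniq := fun s m hm => ?_ }
  · let B : Set X := {x | (s.ι.app (ptJ x)).map PUnit.unit ∈ A}
    change IsOpen B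
    refine hφ1 B ?_
    have := hA.preimage (s.ι.app (Sum.inl B : J)).map.continuous
    have he : (φ1 B).map ⁻¹' B = (s.ι.app (Sum.inl B : J)).map ⁻¹' A :=
      Set.ext fun a => iff_of_eq (congrArg (· ∈ A) (key s (Sum.inl B : J) a))
    rw [he]
    exact this
  · intro U x y hxy
    have hx := (X.circ.mem hxy).1
    have hr := h2 _ x y hxy
    clear hxy
    induction hr with
    | refl => exact s.pt.circ.refl hx
    | @tail p q _ hs ih =>
      refine s.pt.circ.trans ih ?_
      obtain ⟨a, b, hab, ha, hb⟩ := hφ2 (_, p, q) hs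
      have hp := key s (Sum.inr (Sum.inl (_, p, q))) a
      have hq := key s (Sum.inr (Sum.inl (_, p, q))) b
      have ha' : (c (Sum.inr (Sum.inl (_, p, q)))).map a = p := ha
      have hb' : (c (Sum.inr (Sum.inl (_, p, q)))).map b = q := hb
      rw [ha'] at hp
      rw [hb'] at hq
      change s.pt.circ.le U ((s.ι.app (ptJ p)).map PUnit.unit) ((s.ι.app (ptJ q)).map PUnit.unit)
      rw [hp, hq]
      refine (s.ι.app (Sum.inr (Sum.inl (_, p, q)))).mono U a b ?_
      refine (iff_of_eq (congrArg (fun V : Opens (K2 (_, p, q)) => (K2 (_, p, q)).circ.le V a b)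
        (Opens.ext (Set.ext fun z => ?_)))).1 hab
      exact iff_of_eq (congrArg (· ∈ U) (key s (Sum.inr (Sum.inl (_, p, q)) : J) z))
  · ext a
    exact key s j a
  · ext x
    exact congrArg (fun g => Hom.map g PUnit.unit) (hm (ptJ x))

theorem isCompactlyFinal_of_isCompactHausdorff {X : CircSpace.{u}} (h : IsCompactHausdorff X) :
    X.IsCompactlyFinal :=
  ⟨fun _ hA => hA X (𝟙 X) h, fun _ x y hxy => .single ⟨X, 𝟙 X, x, y, h, hxy, rfl, rfl⟩⟩

theorem isWeakHausdorff_of_t2 {X : CircSpace.{u}} (h : T2Space X) : IsWeakHausdorff X :=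
  fun _ _ _ _ _ => inferInstance

/-! ### Cylinders -/

/-- The inclusion of the slice at time `t`. -/
def slice (X : Type u) [TopologicalSpace X] (t : unitInterval) : C(X, X × unitInterval) :=
  ⟨fun x => (x, t), by fun_prop⟩

/-- The product of a stream `X` with the unit interval, the latter with the initial circulation:
the product space, with `(x, s) ≤_W (y, t)` iff `s = t` and `x ≤_{W_s} y`, where
`W_s = {z | (z, s) ∈ W}`. That this is the categorical product is `KStream.cylIsLimit`. -/
def cyl (X : CircSpace.{u}) : CircSpace.{u} where
  carrier := X × unitInterval
  circ :=
    { le := fun W p q => p.2 = q.2 ∧ X.circ.le (W.comap (slice X p.2)) p.1 q.1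
      mem := by
        rintro W ⟨x, s⟩ ⟨y, t⟩ ⟨h, hxy⟩
        obtain rfl : s = t := h
        exact X.circ.mem hxy
      refl := fun {W p} h => ⟨rfl, X.circ.refl h⟩
      trans := by
        rintro W ⟨x, s⟩ ⟨y, t⟩ ⟨z, r⟩ ⟨h, hxy⟩ ⟨h', hyz⟩
        obtain rfl : s = t := h
        exact ⟨h', X.circ.trans hxy hyz⟩
      cosheaf := by
        rintro 𝒪 ⟨x, s⟩ ⟨y, t⟩
        constructor
        · rintro ⟨h, hxy⟩
          obtain rfl : s = t := h
          rw [X.circ.comap_sSup] at hxy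
          refine ⟨hxy.1, hxy.2.lift (fun z => (z, s)) ?_⟩
          rintro a b ⟨U, hU, hab⟩
          exact ⟨U, hU, rfl, hab⟩
        · rintro ⟨hx, hr⟩
          suffices h : ∀ q : X × unitInterval, Relation.ReflTransGen
              (fun a b => ∃ U ∈ 𝒪, a.2 = b.2 ∧ X.circ.le (U.comap (slice X a.2)) a.1 b.1)
              (x, s) q → s = q.2 ∧ X.circ.le ((sSup 𝒪).comap (slice X s)) x q.1 from h _ hr
          intro q hq
          induction hq with
          | refl => exact ⟨rfl, X.circ.refl hx⟩
          | tail _ hs ih =>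
            obtain ⟨U, hU, h, hab⟩ := hs
            refine ⟨ih.1.trans h, X.circ.trans ih.2 ?_⟩
            rw [← ih.1] at hab
            exact X.circ.mono (fun z hz => le_sSup (a := U) hU hz) hab }

theorem isOpen_prod_of_family {P : Type u} [TopologicalSpace P] {ι : Type v}
    {K : ι → CircSpace.{u}} (φ : ∀ i, C(K i, P))
    (h : ∀ A : Set P, (∀ i, IsOpen (φ i ⁻¹' A)) → IsOpen A) (hs : ∀ x, ∃ i a, φ i a = x)
    {A : Set (P × unitInterval)}
    (hA : ∀ i, IsOpen {p : K i × unitInterval | (φ i p.1, p.2) ∈ A}) : IsOpen A := by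
  rw [isOpen_iff_mem_nhds]
  rintro ⟨x, t⟩ hx
  have h1 : IsOpen {s : unitInterval | (x, s) ∈ A} := by
    obtain ⟨i, a, rfl⟩ := hs x
    exact (hA i).preimage (Continuous.prodMk_right a)
  obtain ⟨N, hN, htN, hNA⟩ := exists_compact_subset h1 hx
  have h2 : IsOpen {y : P | ∀ s ∈ N, (y, s) ∈ A} := by
    refine h _ fun i => isOpen_iff_mem_nhds.2 fun a ha => ?_
    exact hN.eventually_forall_of_forall_eventually (x₀ := a)
      (P := fun b s => (φ i b, s) ∈ A) fun s hs' => (hA i).mem_nhds (ha s hs')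
  refine Filter.mem_of_superset
    (prod_mem_nhds (h2.mem_nhds fun s hs' => hNA hs') (mem_interior_iff_mem_nhds.1 htN)) ?_
  rintro ⟨y, s⟩ ⟨hy, hs'⟩
  exact hy s hs'

/-- The map `f × 𝕀`. -/
def cylMap {X Y : CircSpace.{u}} (f : X ⟶ Y) : cyl X ⟶ cyl Y where
  map := ⟨fun p => (f.map p.1, p.2),
    (f.map.continuous.comp continuous_fst).prodMk continuous_snd⟩
  mono := by
    rintro U ⟨x, s⟩ ⟨y, t⟩ ⟨h, hxy⟩
    exact ⟨h, f.mono _ _ _ hxy⟩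

/-- The map `X ≅ X × {t} ↪ X × 𝕀`. -/
def cylIncl (t : unitInterval) (X : CircSpace.{u}) : X ⟶ cyl X where
  map := slice X t
  mono _ _ _ h := ⟨rfl, h⟩

/-- The projection `X × 𝕀 → X`. -/
def cylProj (X : CircSpace.{u}) : cyl X ⟶ X where
  map := ⟨fun p => p.1, continuous_fst⟩
  mono := by
    rintro U ⟨x, s⟩ ⟨y, t⟩ ⟨_, hxy⟩
    exact hxy

theorem isCompactHausdorff_cyl {X : CircSpace.{u}} (h : IsCompactHausdorff X) :
    IsCompactHausdorff (cyl X) := by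
  obtain ⟨_, _⟩ := h
  exact ⟨inferInstanceAs (CompactSpace (X × unitInterval)),
    inferInstanceAs (T2Space (X × unitInterval))⟩

theorem IsCompactlyFinal.cyl {X : CircSpace.{u}} (h : X.IsCompactlyFinal) :
    (cyl X).IsCompactlyFinal := by
  constructor
  · intro A hA
    let ι := Σ K : { K : CircSpace.{u} // IsCompactHausdorff K }, (K.1 ⟶ X)
    refine isOpen_prod_of_family (ι := ι) (K := fun i => i.1.1) (fun i => i.2.map)
      (fun B hB => h.1 B fun K φ hK => hB ⟨⟨K, hK⟩, φ⟩) (fun x => ?_) fun i =>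
        hA _ (cylMap i.2) (isCompactHausdorff_cyl i.1.2)
    exact ⟨⟨⟨ofSpace PUnit, inferInstanceAs (CompactSpace PUnit), inferInstanceAs (T2Space PUnit)⟩,
      ofSpaceHom (ContinuousMap.const _ x)⟩, PUnit.unit, rfl⟩
  · rintro W ⟨x, s⟩ ⟨y, t⟩ ⟨hst, hxy⟩
    obtain rfl : s = t := hst
    refine (h.2 _ _ _ hxy).lift (fun z => (z, s)) ?_
    rintro p q ⟨K, φ, a, b, hK, hab, rfl, rfl⟩
    exact ⟨CircSpace.cyl K, cylMap φ, (a, s), (b, s), isCompactHausdorff_cyl hK, ⟨rfl, hab⟩, rfl,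
      rfl⟩

theorem IsWeakHausdorff.cyl {X : CircSpace.{u}} (h : IsWeakHausdorff X) :
    IsWeakHausdorff (cyl X) := by
  intro K _ _ _ φ
  let φ' : C(K, X × unitInterval) := φ
  change T2Space (Set.range φ')
  let ψ : C(K, X) := ⟨fun k => (φ' k).1, by fun_prop⟩
  have := h K ψ
  let f : Set.range φ' → Set.range ψ × unitInterval := fun p =>
    (⟨p.1.1, by obtain ⟨_, k, rfl⟩ := p; exact ⟨k, rfl⟩⟩, p.1.2)
  refine T2Space.of_injective_continuous (f := f) ?_ ?_
  · intro p q hpq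
    have h1 := congrArg (fun z => z.1.1) hpq
    have h2 := congrArg (fun z => z.2) hpq
    exact Subtype.ext (Prod.ext h1 h2)
  · fun_prop

/-! ### Path streams -/

/-- A stream map `K × 𝕀 → E` with `K` a compact Hausdorff stream. -/
structure PathTest (E : CircSpace.{u}) : Type (u + 1) where
  dom : CircSpace.{u}
  isCompactHausdorff : IsCompactHausdorff dom
  hom : cyl dom ⟶ E

/-- The function `K → C(𝕀, E)` corresponding to a stream map `K × 𝕀 → E`. -/
def curryFun {Z E : CircSpace.{u}} (f : cyl Z ⟶ E) (z : Z) : C(unitInterval, E) :=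
  ⟨fun t => f.map (z, t), f.map.continuous.comp (Continuous.prodMk_right z)⟩

/-- The exponential `E^𝕀`: the stream of all paths in `E` (all continuous maps `𝕀 → E`, which are
the stream maps from `𝕀` with its initial circulation), with the final topology and circulation for
the functions adjoint to stream maps `K × 𝕀 → E`, `K` compact Hausdorff.
That this is right adjoint to `- × 𝕀` is `KStream.cylPathAdj`. -/
def path (E : CircSpace.{u}) : CircSpace.{u} :=
  finalSpace C(unitInterval, E) (fun T : PathTest E => T.dom) fun T => curryFun T.hom

/-- The adjoint of a stream map from the cylinder on a compactly final stream. -/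
def curry {Z E : CircSpace.{u}} (hZ : Z.IsCompactlyFinal) (f : cyl Z ⟶ E) : Z ⟶ path E where
  map := ⟨curryFun f, ⟨fun A hA => hZ.1 _ fun K φ hK =>
    isOpen_finalSpace.1 hA ⟨K, hK, cylMap φ ≫ f⟩⟩⟩
  mono U x y hxy := by
    refine ⟨(Z.circ.mem hxy).1, ?_⟩
    refine (hZ.2 _ _ _ hxy).lift (curryFun f) ?_
    rintro p q ⟨K, φ, a, b, hK, hab, rfl, rfl⟩
    exact ⟨⟨K, hK, cylMap φ ≫ f⟩, a, b, hab, rfl, rfl⟩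

/-- Evaluation `E^𝕀 → E` at time `t`, that is, `E^{{t} ↪ 𝕀}`. -/
def pathEval (t : unitInterval) (E : CircSpace.{u}) : path E ⟶ E :=
  finalDesc (fun γ => γ t) fun T => ⟨cylIncl t T.dom ≫ T.hom, fun _ => rfl⟩

/-- The map `f^𝕀`. -/
def pathMap {E E' : CircSpace.{u}} (f : E ⟶ E') : path E ⟶ path E' :=
  finalDesc (fun γ => f.map.comp γ) fun T =>
    ⟨finalMap (fun T : PathTest E' => T.dom) (fun T => curryFun T.hom)
      ⟨T.dom, T.isCompactHausdorff, T.hom ≫ f⟩, fun _ => rfl⟩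

theorem isCompactlyFinal_path (E : CircSpace.{u}) : (path E).IsCompactlyFinal := by
  constructor
  · intro A hA
    exact isOpen_finalSpace.2 fun T => hA T.dom
      (finalMap (fun T : PathTest E => T.dom) (fun T => curryFun T.hom) T) T.isCompactHausdorff
  · rintro U x y ⟨_, hr⟩
    refine Relation.ReflTransGen.mono ?_ _ _ hr
    rintro p q ⟨T, a, b, hab, hp, hq⟩
    exact ⟨T.dom, finalMap (fun T : PathTest E => T.dom) (fun T => curryFun T.hom) T, a, b,
      T.isCompactHausdorff, hab, hp, hq⟩

theorem IsWeakHausdorff.path {E : CircSpace.{u}} (h : IsWeakHausdorff E) :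
    IsWeakHausdorff (path E) := by
  intro K _ _ _ φ
  have hT : ∀ t : unitInterval, T2Space (Set.range ((pathEval t E).map.comp φ)) := fun t =>
    h K ((pathEval t E).map.comp φ)
  let f : Set.range φ → ∀ t : unitInterval, Set.range ((pathEval t E).map.comp φ) := fun p t =>
    ⟨(pathEval t E).map p.1, by obtain ⟨_, k, rfl⟩ := p; exact ⟨k, rfl⟩⟩
  refine T2Space.of_injective_continuous (f := f) ?_ ?_
  · intro p q hpq
    exact Subtype.ext (ContinuousMap.ext fun t => congrArg Subtype.val (congrFun hpq t))
  · refine continuous_pi fun t => Continuous.subtype_mk ?_ _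
    exact (pathEval t E).map.continuous.comp continuous_subtype_val

/-- The evaluation `E^𝕀 × 𝕀 → E`. -/
def pathEv (E : CircSpace.{u}) : cyl (path E) ⟶ E where
  map := ⟨fun p => (pathEval p.2 E).map p.1, ⟨fun A hA => by
    refine isOpen_prod_of_family (P := path E) (K := fun T : PathTest E => T.dom)
      (fun T => (finalMap (fun T : PathTest E => T.dom) (fun T => curryFun T.hom) T).map)
      (fun B hB => isOpen_finalSpace.2 hB) (fun γ => ?_) fun T => hA.preimage T.hom.map.continuous
    let γ' : C(unitInterval, E) := γ
    refine ⟨⟨ofSpace PUnit, ⟨inferInstanceAs (CompactSpace PUnit),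
      inferInstanceAs (T2Space PUnit)⟩,
      ⟨⟨fun p => γ' p.2, γ'.continuous.comp continuous_snd⟩, ?_⟩⟩, PUnit.unit, rfl⟩
    rintro U ⟨x, s⟩ ⟨y, t⟩ ⟨hst, _, hx⟩
    obtain rfl : s = t := hst
    exact E.circ.refl hx⟩⟩
  mono := by
    rintro U ⟨γ, s⟩ ⟨γ', t⟩ ⟨hst, h⟩
    obtain rfl : s = t := hst
    exact (pathEval s E).mono U γ γ' h

end CircSpace

/-! ### The category of weak Hausdorff k-streams -/

/-- The category of weak Hausdorff k-streams and stream maps. -/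
abbrev KStream : Type (u + 1) :=
  (CircSpace.IsKStream.{u} ⊓ CircSpace.IsWeakHausdorff.{u}).FullSubcategory

namespace KStream

open CircSpace

instance : CoeSort KStream.{u} (Type u) := ⟨fun X => X.obj.carrier⟩

/-- Compact Hausdorff spaces as streams, with the initial circulation. -/
def ofCompactHausdorff (X : Type u) [TopologicalSpace X] [CompactSpace X] [T2Space X] :
    KStream.{u} :=
  ⟨ofSpace X, (isCompactlyFinal_of_isCompactHausdorff
    ⟨inferInstanceAs (CompactSpace X), inferInstanceAs (T2Space X)⟩).isKStream,
    isWeakHausdorff_of_t2 (inferInstanceAs (T2Space X))⟩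

/-- The unit interval `𝕀`, with the initial circulation. -/
def interval : KStream.{u} := ofCompactHausdorff (ULift.{u} unitInterval)

/-- The one-point stream `{0}`. -/
def point : KStream.{u} := ofCompactHausdorff PUnit

/-- The inclusion `{0} ↪ 𝕀`. -/
def zero : point.{u} ⟶ interval.{u} :=
  ObjectProperty.homMk (ofSpaceHom (ContinuousMap.const _ (ULift.up 0)))

/-- The map to the one-point stream. -/
def toPoint (X : KStream.{u}) : X ⟶ point.{u} :=
  ObjectProperty.homMk ⟨ContinuousMap.const _ PUnit.unit, fun _ _ _ h =>
    ⟨rfl, (X.obj.circ.mem h).1⟩⟩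

/-- The functor `- × 𝕀`. -/
def cylinder : KStream.{u} ⥤ KStream.{u} where
  obj X := ⟨cyl X.obj, X.property.1.isCompactlyFinal.cyl.isKStream, X.property.2.cyl⟩
  map f := ObjectProperty.homMk (cylMap f.hom)

/-- The natural map `X × {t} ↪ X × 𝕀`. -/
def incl (t : unitInterval) : 𝟭 KStream.{u} ⟶ cylinder where
  app X := ObjectProperty.homMk (cylIncl t X.obj)

/-- The natural projection `X × 𝕀 → X`. -/
def proj : cylinder.{u} ⟶ 𝟭 KStream.{u} where
  app X := ObjectProperty.homMk (cylProj X.obj)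

/-- The functor `(-)^𝕀`. -/
def pathStream : KStream.{u} ⥤ KStream.{u} where
  obj E := ⟨path E.obj, (isCompactlyFinal_path E.obj).isKStream, E.property.2.path⟩
  map f := ObjectProperty.homMk (pathMap f.hom)

/-- The natural map `E^{{t} ↪ 𝕀} : E^𝕀 → E`. -/
def eval (t : unitInterval) : pathStream.{u} ⟶ 𝟭 KStream.{u} where
  app E := ObjectProperty.homMk (pathEval t E.obj)

/-- `(-)^𝕀` is right adjoint to `- × 𝕀`. -/
def cylPathAdj : cylinder.{u} ⊣ pathStream.{u} :=
  Adjunction.mkOfHomEquiv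
    { homEquiv := fun X Y =>
        { toFun := fun f => ObjectProperty.homMk (curry X.property.1.isCompactlyFinal f.hom)
          invFun := fun g => ObjectProperty.homMk (cylMap g.hom ≫ pathEv Y.obj)
          left_inv := fun _ => rfl
          right_inv := fun _ => rfl }
      homEquiv_naturality_left_symm := fun _ _ => rfl
      homEquiv_naturality_right := fun _ _ => rfl }

/-- The projection `X × 𝕀 → 𝕀`. -/
def time (X : KStream.{u}) : cylinder.obj X ⟶ interval.{u} :=
  ObjectProperty.homMk
    { map := ⟨fun p => ULift.up p.2, continuous_uliftUp.comp continuous_snd⟩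
      mono := by
        rintro U ⟨x, s⟩ ⟨y, t⟩ ⟨h, hxy⟩
        exact ⟨congrArg ULift.up h, (X.obj.circ.mem hxy).1⟩ }

/-- `X × 𝕀` is the product of `X` and `𝕀` in the category of weak Hausdorff k-streams. -/
def cylIsLimit (X : KStream.{u}) : IsLimit (BinaryFan.mk (proj.app X) (time X)) :=
  BinaryFan.isLimitMk
    (fun s => ObjectProperty.homMk
      { map := ⟨fun z => (s.fst.hom.map z, (s.snd.hom.map z).down),
          s.fst.hom.map.continuous.prodMk
            (continuous_uliftDown.comp s.snd.hom.map.continuous)⟩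
        mono := by
          intro W x y hxy
          let ψ : C(s.pt, X × unitInterval) := ⟨fun z => (s.fst.hom.map z, (s.snd.hom.map z).down),
            s.fst.hom.map.continuous.prodMk
              (continuous_uliftDown.comp s.snd.hom.map.continuous)⟩
          let W' : Opens (X × unitInterval) := W
          let 𝒪 : Set (Opens (X × unitInterval)) :=
            {B | B ≤ W' ∧ ∃ (V : Opens X) (O : Opens unitInterval),
              (B : Set (X × unitInterval)) = (V : Set X) ×ˢ (O : Set unitInterval)}
          have hW : W' = sSup 𝒪 := by
            refine le_antisymm ?_ (sSup_le fun B hB => hB.1)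
            rintro ⟨a, t⟩ hat
            obtain ⟨V, O, hV, hO, ha, ht, h⟩ := isOpen_prod_iff.1 W'.2 a t hat
            exact Opens.mem_sSup.2 ⟨⟨V ×ˢ O, hV.prod hO⟩, ⟨h, ⟨V, hV⟩, ⟨O, hO⟩, rfl⟩, ha, ht⟩
          change s.pt.obj.circ.le (W'.comap ψ) x y at hxy
          change (CircSpace.cyl X.obj).circ.le W' (ψ x) (ψ y)
          have hx : ψ x ∈ W' := (s.pt.obj.circ.mem hxy).1
          rw [hW, s.pt.obj.circ.comap_sSup] at hxy
          replace hxy := hxy.2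
          induction hxy with
          | refl => exact (CircSpace.cyl X.obj).circ.refl hx
          | @tail p q _ hs ih =>
            obtain ⟨B, ⟨hB, V, O, hVO⟩, hpq⟩ := hs
            refine (CircSpace.cyl X.obj).circ.trans ih ?_
            have hmem : ∀ z, ψ z ∈ B ↔ s.fst.hom.map z ∈ V ∧ (s.snd.hom.map z).down ∈ O := by
              intro z
              rw [← SetLike.mem_coe, hVO]
              rfl
            have h2 := s.snd.hom.mono ⊤ p q (s.pt.obj.circ.mono le_top hpq)
            have h3 := s.fst.hom.mono V p q (s.pt.obj.circ.mono (fun z hz => ((hmem z).1 hz).1) hpq)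
            have hp : (s.snd.hom.map p).down ∈ O := ((hmem p).1 (s.pt.obj.circ.mem hpq).1).2
            refine ⟨congrArg ULift.down h2.1, X.obj.circ.mono (fun a ha => hB ?_) h3⟩
            rw [← SetLike.mem_coe, hVO]
            exact ⟨ha, hp⟩ })
    (fun s => rfl) (fun s => rfl)
    (fun s m h₁ h₂ => by
      apply ObjectProperty.hom_ext
      apply CircSpace.hom_ext
      intro z
      have e1 := congrArg (fun g => g.hom.map z) h₁
      have e2 := congrArg (fun g => (g.hom.map z).down) h₂
      exact Prod.ext e1 e2)

end KStream

/-! ### Diagrams of streams -/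

namespace DiagStream

open KStream

variable {G : Type u} [SmallCategory G]

/-- The diagram `X × 𝕀`. -/
abbrev cyl (X : G ⥤ KStream.{u}) : G ⥤ KStream.{u} := X ⋙ cylinder

/-- The map `e × 𝕀`. -/
abbrev cylMap {X Y : G ⥤ KStream.{u}} (e : X ⟶ Y) : cyl X ⟶ cyl Y :=
  Functor.whiskerRight e cylinder

/-- The map `X × ({t} ↪ 𝕀)`. -/
def cylIncl (t : unitInterval) (X : G ⥤ KStream.{u}) : X ⟶ cyl X := Functor.whiskerLeft X (incl t)

/-- The projection `X × 𝕀 → X`. -/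
def cylProj (X : G ⥤ KStream.{u}) : cyl X ⟶ X := Functor.whiskerLeft X proj

/-- The diagram `E^𝕀`. -/
abbrev path (E : G ⥤ KStream.{u}) : G ⥤ KStream.{u} := E ⋙ pathStream

/-- The map `E^{{t} ↪ 𝕀} : E^𝕀 → E`. -/
def pathEval (t : unitInterval) (E : G ⥤ KStream.{u}) : path E ⟶ E := Functor.whiskerLeft E (eval t)

/-- `h : f ∼ g`. -/
def IsHomotopy {Y Z : G ⥤ KStream.{u}} (h : cyl Y ⟶ Z) (f g : Y ⟶ Z) : Prop :=
  cylIncl 0 Y ≫ h = f ∧ cylIncl 1 Y ≫ h = g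

/-- `f ∼ g`. -/
def Homotopic {Y Z : G ⥤ KStream.{u}} (f g : Y ⟶ Z) : Prop := ∃ h : cyl Y ⟶ Z, IsHomotopy h f g

/-- `f ∼ g` relative `e`: there is a homotopy `h : f ∼ g` whose restriction along `e × 𝕀` is the
constant homotopy at `fe = ge`. -/
def HomotopicRel {X Y Z : G ⥤ KStream.{u}} (e : X ⟶ Y) (f g : Y ⟶ Z) : Prop :=
  e ≫ f = e ≫ g ∧ ∃ h : cyl Y ⟶ Z, IsHomotopy h f g ∧ cylMap e ≫ h = cylProj X ≫ e ≫ f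

/-- h-acyclic maps, also called h-equivalences. -/
def IsHAcyclic {X Y : G ⥤ KStream.{u}} (f : X ⟶ Y) : Prop :=
  ∃ g : Y ⟶ X, Homotopic (f ≫ g) (𝟙 X) ∧ Homotopic (g ≫ f) (𝟙 Y)

/-- h-fibrations: maps with the RLP against `X × ({0} ↪ 𝕀)` for every diagram `X`. -/
def IsHFibration {E B : G ⥤ KStream.{u}} (p : E ⟶ B) : Prop :=
  ∀ X : G ⥤ KStream.{u}, HasLiftingProperty (cylIncl 0 X) p

/-- h-cofibrations: maps with the LLP against `E^{{0} ↪ 𝕀}` for every diagram `E`. -/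
def IsHCofibration {X Y : G ⥤ KStream.{u}} (e : X ⟶ Y) : Prop :=
  ∀ E : G ⥤ KStream.{u}, HasLiftingProperty e (pathEval 0 E)

/-- The unit interval as a constant diagram. -/
abbrev interval (G : Type u) [SmallCategory G] : G ⥤ KStream.{u} :=
  (Functor.const G).obj KStream.interval

/-- The one-point stream `{0}` as a constant diagram. -/
abbrev point (G : Type u) [SmallCategory G] : G ⥤ KStream.{u} :=
  (Functor.const G).obj KStream.point

/-- The inclusion `{0} ↪ 𝕀` of constant diagrams. -/
abbrev zero (G : Type u) [SmallCategory G] : point G ⟶ interval G :=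
  (Functor.const G).map KStream.zero

/-- The map to the one-point diagram. -/
def toPoint (X : G ⥤ KStream.{u}) : X ⟶ point G where
  app o := KStream.toPoint (X.obj o)

/-- Neighborhood deformation retracts. -/
def IsNDR {X Y : G ⥤ KStream.{u}} (e : X ⟶ Y) : Prop :=
  ∃ u : Y ⟶ interval G, IsPullback e (toPoint X) u (zero G) ∧
    ∃ f : Y ⟶ Y, HomotopicRel e f (𝟙 Y) ∧
      ∀ (o : G) (y : Y.obj o), ((u.app o).hom.map y).down < 1 →
        (f.app o).hom.map y ∈ Set.range (e.app o).hom.map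

end DiagStream

/-! ### Stream maps as a predicate on functions -/

namespace CircSpace

variable {X Y Z : CircSpace.{u}}

/-- The function `f` underlies a stream map. -/
structure IsStream (f : X → Y) : Prop where
  continuous : Continuous f
  -- Any `V` carried into `U` is allowed in place of the preimage of `U`. By monotonicity of
  -- circulations this is equivalent, and it avoids comparing preimages under composites.
  mono : ∀ {V : Opens X} {U : Opens Y} {x y : X}, X.circ.le V x y → (∀ z ∈ V, f z ∈ U) →
    Y.circ.le U (f x) (f y)

theorem Hom.isStream (f : X ⟶ Y) : IsStream f.map :=
  ⟨f.map.continuous, fun h hV => f.mono _ _ _ (X.circ.mono hV h)⟩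

/-- The stream map underlain by a function. -/
def IsStream.hom {f : X → Y} (hf : IsStream f) : X ⟶ Y :=
  ⟨⟨f, hf.continuous⟩, fun _ _ _ h => hf.mono h fun _ hz => hz⟩

theorem IsStream.comp {g : Y → Z} {f : X → Y} (hg : IsStream g) (hf : IsStream f) :
    IsStream fun x => g (f x) :=
  (hf.hom ≫ hg.hom).isStream

theorem IsStream.congr {f g : X → Y} (hf : IsStream f) (h : ∀ x, g x = f x) : IsStream g := by
  rwa [funext h]

theorem IsStream.id : IsStream fun x : X => x := Hom.isStream (𝟙 X)

/-- A continuous function that is constant along the preorder of a stream. -/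
structure IsTime {T : Type*} [TopologicalSpace T] (w : X → T) : Prop where
  continuous : Continuous w
  eq : ∀ {x y : X}, X.circ.le ⊤ x y → w x = w y

namespace IsTime

variable {T S R : Type*} [TopologicalSpace T] [TopologicalSpace S] [TopologicalSpace R]

theorem comp {w : X → T} (hw : IsTime w) {θ : T → S} (hθ : Continuous θ) :
    IsTime fun x => θ (w x) :=
  ⟨hθ.comp hw.continuous, fun h => congrArg θ (hw.eq h)⟩

theorem comp₂ {w : X → T} {w' : X → S} (hw : IsTime w) (hw' : IsTime w') {θ : T → S → R}
    (hθ : Continuous fun p : T × S => θ p.1 p.2) : IsTime fun x => θ (w x) (w' x) :=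
  ⟨hθ.comp (hw.continuous.prodMk hw'.continuous), fun h => congrArg₂ θ (hw.eq h) (hw'.eq h)⟩

theorem comp_isStream {w : Y → T} (hw : IsTime w) {f : X → Y} (hf : IsStream f) :
    IsTime fun x => w (f x) :=
  ⟨hw.continuous.comp hf.continuous, fun h => hw.eq (hf.mono h fun _ _ => trivial)⟩

theorem snd : IsTime (X := cyl X) fun p => p.2 := ⟨continuous_snd, fun h => h.1⟩

theorem of_hom {T : Type u} [TopologicalSpace T] (f : X ⟶ ofSpace T) : IsTime (T := T) f.map :=
  ⟨f.map.continuous, fun {x y} h => (f.mono ⊤ x y h).1⟩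

theorem isStream {T : Type u} [TopologicalSpace T] {w : X → T} (hw : IsTime w) :
    IsStream (Y := ofSpace T) w :=
  ⟨hw.continuous, fun {_ _ x _} h hV => ⟨hw.eq (X.circ.mono le_top h), hV x (X.circ.mem h).1⟩⟩

end IsTime

/-! ### Closed upper sets -/

/-- Closed sets that are upper sets for the preorder on the whole stream. -/
structure ClosedUpper (X : CircSpace.{u}) where
  carrier : Set X
  isClosed : IsClosed carrier
  upper : ∀ {x y : X}, X.circ.le ⊤ x y → x ∈ carrier → y ∈ carrier

/-- The preimage of a closed set under a function constant along the preorder. -/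
def IsTime.closedUpper {T : Type*} [TopologicalSpace T] {w : X → T} (hw : IsTime w) {C : Set T}
    (hC : IsClosed C) : ClosedUpper X :=
  ⟨w ⁻¹' C, hC.preimage hw.continuous, fun h hx => by
    rw [Set.mem_preimage, ← hw.eq h]; exact hx⟩

namespace ClosedUpper

variable (C : ClosedUpper X)

/-- The complement as an open set. -/
def compl : Opens X := ⟨C.carrierᶜ, C.isClosed.isOpen_compl⟩

variable {C}

/-- `V` is covered by `V ⊓ V'` and the complement of `C`, so the cosheaf condition breaks `x ≤ y`
into steps inside these two sets. A chain starting in the upper set `C` never leaves it, hence never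
uses the complement. -/
theorem le_of_inter {V V' : Opens X} (hV : ∀ z ∈ V, z ∈ C.carrier → z ∈ V') {x y : X}
    (h : X.circ.le V x y) (hx : x ∈ C.carrier) : X.circ.le V' x y := by
  have hxV := (X.circ.mem h).1
  have hc : V ≤ sSup {V ⊓ V', C.compl} := by
    rw [sSup_pair]
    intro z hz
    by_cases hzC : z ∈ C.carrier
    · exact Or.inl ⟨hz, hV z hz hzC⟩
    · exact Or.inr hzC
  have h' := ((X.circ.cosheaf _ _ _).1 (X.circ.mono hc h)).2
  suffices key : y ∈ C.carrier ∧ X.circ.le V' x y from key.2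
  clear h
  induction h' with
  | refl => exact ⟨hx, X.circ.refl (hV x hxV hx)⟩
  | tail _ hs ih =>
    obtain ⟨U, rfl | rfl, hU⟩ := hs
    · exact ⟨C.upper (X.circ.mono le_top hU) ih.1, X.circ.trans ih.2
        (X.circ.mono inf_le_right hU)⟩
    · exact absurd ih.1 (X.circ.mem hU).1

variable (C)

/-- The largest open set with given trace on a closed set. -/
def extend (U : Opens C.carrier) : Opens X :=
  ⟨{z | ∀ h : z ∈ C.carrier, ⟨z, h⟩ ∈ U}, by
    obtain ⟨V, hV, hVU⟩ := isOpen_induced_iff.1 U.2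
    convert hV.union C.isClosed.isOpen_compl using 1
    ext z
    by_cases hz : z ∈ C.carrier
    · have : (⟨z, hz⟩ : C.carrier) ∈ U ↔ z ∈ V := by
        rw [← SetLike.mem_coe]; change _ ∈ U.carrier ↔ _; rw [← hVU]; rfl
      simp [hz, this]
    · simp [hz]⟩

/-- The substream on a closed upper set. -/
def sub : CircSpace.{u} where
  carrier := C.carrier
  circ :=
    { le := fun U x y => X.circ.le (C.extend U) x y
      mem := fun {U x y} h => ⟨(X.circ.mem h).1 x.2, (X.circ.mem h).2 y.2⟩
      refl := fun h => X.circ.refl fun _ => h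
      trans := fun h h' => X.circ.trans h h'
      cosheaf := by
        intro 𝒪 x y
        constructor
        · intro h
          refine ⟨(X.circ.mem h).1 x.2, ?_⟩
          -- Each `C.extend U` already contains the complement of `C`; inserting it separately
          -- covers the case of empty `𝒪`.
          have hc : C.extend (sSup 𝒪) ≤ sSup (insert C.compl (C.extend '' 𝒪)) := by
            intro z hz
            by_cases hzC : z ∈ C.carrier
            · obtain ⟨U, hU, hzU⟩ := Opens.mem_sSup.1 (hz hzC)
              exact Opens.mem_sSup.2 ⟨C.extend U, Or.inr ⟨U, hU, rfl⟩, fun _ => hzU⟩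
            · exact Opens.mem_sSup.2 ⟨C.compl, Or.inl rfl, hzC⟩
          have h' := ((X.circ.cosheaf _ _ _).1 (X.circ.mono hc h)).2
          suffices key : ∀ q : X, Relation.ReflTransGen
              (fun a b => ∃ U ∈ insert C.compl (C.extend '' 𝒪), X.circ.le U a b) x q →
              ∃ hq : q ∈ C.carrier, Relation.ReflTransGen
                (fun a b : C.carrier => ∃ U ∈ 𝒪, X.circ.le (C.extend U) a b) x ⟨q, hq⟩ from
            (key y h').2
          intro q hq
          induction hq with
          | refl => exact ⟨x.2, .refl⟩
          | tail _ hs ih =>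
            obtain ⟨hp, ih⟩ := ih
            obtain ⟨_, rfl | ⟨U, hU, rfl⟩, hpq⟩ := hs
            · exact absurd hp (X.circ.mem hpq).1
            · exact ⟨C.upper (X.circ.mono le_top hpq) hp, ih.tail ⟨U, hU, hpq⟩⟩
        · rintro ⟨hx, hr⟩
          induction hr with
          | refl => exact X.circ.refl fun _ => hx
          | tail _ hs ih =>
            obtain ⟨U, hU, hpq⟩ := hs
            exact X.circ.trans ih (X.circ.mono (U := C.extend U) (V := C.extend (sSup 𝒪))
              (fun z hz hzC => le_sSup (a := U) hU (hz hzC)) hpq) }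

theorem isStream_val : IsStream (X := C.sub) fun x => x.1 :=
  ⟨continuous_subtype_val, fun {V _ x _} h hV =>
    le_of_inter (C := C) (V := C.extend V) (fun z hz hzC => hV ⟨z, hzC⟩ (hz hzC)) h x.2⟩

variable {C}

theorem isStream_codRestrict {f : Z → X} (hf : IsStream f) (h : ∀ z, f z ∈ C.carrier) :
    IsStream (Y := C.sub) fun z => ⟨f z, h z⟩ :=
  ⟨hf.continuous.subtype_mk h, fun {_ U _ _} hab hV =>
    hf.mono (U := C.extend U) hab fun z hz _ => hV z hz⟩

/-- The preimage of a closed upper set under a stream map. -/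
def preimage (C : ClosedUpper X) {f : Z → X} (hf : IsStream f) : ClosedUpper Z :=
  ⟨f ⁻¹' C.carrier, C.isClosed.preimage hf.continuous, fun h hx =>
    C.upper (hf.mono h fun _ _ => trivial) hx⟩

variable (C)

theorem isCompactHausdorff_sub (h : IsCompactHausdorff X) : IsCompactHausdorff C.sub := by
  obtain ⟨_, _⟩ := h
  exact ⟨isCompact_iff_compactSpace.1 C.isClosed.isCompact, inferInstanceAs (T2Space C.carrier)⟩

/-- A test map `K → X` restricts to the preimage of `C`, a closed upper set of `K` and so again a
compact Hausdorff stream. A chain of test relations that starts in `C` stays in `C`, so every step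
restricts. -/
theorem isCompactlyFinal_sub (h : X.IsCompactlyFinal) : C.sub.IsCompactlyFinal := by
  have hsub : ∀ {K : CircSpace.{u}} (φ : K ⟶ X), IsStream (X := (C.preimage φ.isStream).sub)
      (Y := C.sub) fun a => ⟨φ.map a.1, a.2⟩ := fun φ =>
    isStream_codRestrict (φ.isStream.comp (C.preimage φ.isStream).isStream_val) fun a => a.2
  constructor
  · intro A hA
    have h1 : IsOpen {z : X | ∀ hz : z ∈ C.carrier, (⟨z, hz⟩ : C.carrier) ∈ A} := by
      refine h.1 _ fun K φ hK => ?_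
      exact ((C.preimage φ.isStream).extend
        ⟨_, hA _ (hsub φ).hom ((C.preimage φ.isStream).isCompactHausdorff_sub hK)⟩).2
    have h2 := h1.preimage (continuous_subtype_val (p := (· ∈ C.carrier)))
    have h3 : A = Subtype.val ⁻¹' {z : X | ∀ hz : z ∈ C.carrier, (⟨z, hz⟩ : C.carrier) ∈ A} :=
      Set.ext fun z => ⟨fun hz _ => hz, fun hz => hz z.2⟩
    rw [h3]
    exact h2
  · intro U x y hxy
    have h' := h.2 _ _ _ hxy
    suffices key : ∀ q : X, Relation.ReflTransGen
        (fun p q => ∃ (K : CircSpace.{u}) (φ : K ⟶ X) (a b : K), IsCompactHausdorff K ∧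
          K.circ.le ((C.extend U).comap φ.map) a b ∧ φ.map a = p ∧ φ.map b = q) x.1 q →
        ∃ hq : q ∈ C.carrier, Relation.ReflTransGen
          (fun p q : C.sub => ∃ (K : CircSpace.{u}) (φ : K ⟶ C.sub) (a b : K),
            IsCompactHausdorff K ∧ K.circ.le (Opens.comap φ.map U) a b ∧ φ.map a = p ∧
            φ.map b = q) x ⟨q, hq⟩ from (key y.1 h').2
    intro q hq
    induction hq with
    | refl => exact ⟨x.2, .refl⟩
    | tail _ hs ih =>
      obtain ⟨hp, ih⟩ := ih
      obtain ⟨K, φ, a, b, hK, hab, rfl, rfl⟩ := hs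
      have hb : b ∈ (C.preimage φ.isStream).carrier :=
        (C.preimage φ.isStream).upper (K.circ.mono le_top hab) hp
      exact ⟨hb, ih.tail ⟨_, (hsub φ).hom, ⟨a, hp⟩, ⟨b, hb⟩,
        (C.preimage φ.isStream).isCompactHausdorff_sub hK, hab, rfl, rfl⟩⟩

theorem isWeakHausdorff_sub (h : IsWeakHausdorff X) : IsWeakHausdorff C.sub := by
  intro K _ _ _ φ
  let φ : C(K, C.carrier) := φ
  change T2Space (Set.range φ)
  let ψ : C(K, X) := ⟨fun k => (φ k).1, continuous_subtype_val.comp φ.continuous⟩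
  have := h K ψ
  let f : Set.range φ → Set.range ψ := fun p =>
    ⟨p.1.1, by obtain ⟨_, k, rfl⟩ := p; exact ⟨k, rfl⟩⟩
  refine T2Space.of_injective_continuous (f := f) ?_ ?_
  · intro p q hpq
    exact Subtype.ext (Subtype.ext (congrArg (fun z => z.1) hpq))
  · exact (continuous_subtype_val.comp continuous_subtype_val).subtype_mk _

end ClosedUpper

/-! ### Pasting -/

/-- Continuity is the usual pasting over two closed sets. For the preorder only the smaller point
`x` matters: the member of the cover that contains `x` contains everything above `x`. -/
theorem IsStream.of_cover {f : X → Y} (C C' : ClosedUpper X)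
    (hC : ∀ x, x ∈ C.carrier ∨ x ∈ C'.carrier) (h : IsStream (X := C.sub) fun x => f x.1)
    (h' : IsStream (X := C'.sub) fun x => f x.1) : IsStream f := by
  constructor
  · have h1 : ContinuousOn f C.carrier := continuousOn_iff_continuous_domRestrict.2 h.continuous
    have h2 : ContinuousOn f C'.carrier := continuousOn_iff_continuous_domRestrict.2 h'.continuous
    have := h1.union_of_isClosed h2 C.isClosed C'.isClosed
    rwa [show C.carrier ∪ C'.carrier = Set.univ from Set.eq_univ_of_forall hC,
      continuousOn_univ] at this
  · have key : ∀ (D : ClosedUpper X), IsStream (X := D.sub) (fun x => f x.1) →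
        ∀ {V : Opens X} {U : Opens Y} {x y : X}, X.circ.le V x y → (∀ z ∈ V, f z ∈ U) →
        x ∈ D.carrier → Y.circ.le U (f x) (f y) := by
      intro D hD V U x y hxy hV hx
      have hy := D.upper (X.circ.mono le_top hxy) hx
      refine hD.mono (V := V.comap ⟨Subtype.val, continuous_subtype_val⟩) (x := ⟨x, hx⟩)
        (y := ⟨y, hy⟩) (X.circ.mono (V := D.extend _) (fun z hz _ => hz) hxy) fun z hz => hV _ hz
    intro V U x y hxy hV
    rcases hC x with hx | hx
    · exact key C h hxy hV hx
    · exact key C' h' hxy hV hx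

theorem IsStream.ite {f g : X → Y} (hf : IsStream f) (hg : IsStream g) {w w' : X → ℝ}
    (hw : IsTime w) (hw' : IsTime w') (h : ∀ x, w x = w' x → f x = g x)
    [∀ x, Decidable (w x ≤ w' x)] : IsStream fun x => if w x ≤ w' x then f x else g x := by
  have hd : IsTime fun x => w' x - w x := hw'.comp₂ hw (by fun_prop)
  refine of_cover (hd.closedUpper (isClosed_Ici (a := 0)))
    (hd.closedUpper (isClosed_Iic (a := 0))) (fun x => le_total (0 : ℝ) (w' x - w x)) ?_ ?_
  · have := hf.comp (hd.closedUpper (isClosed_Ici (a := 0))).isStream_val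
    convert this using 2 with x
    have : (0 : ℝ) ≤ w' x.1 - w x.1 := x.2
    exact if_pos (by linarith)
  · have := hg.comp (hd.closedUpper (isClosed_Iic (a := 0))).isStream_val
    convert this using 2 with x
    have : w' x.1 - w x.1 ≤ (0 : ℝ) := x.2
    split_ifs with hx
    · exact h _ (by linarith)
    · rfl

/-- Comparable points have the same `w`-value, and a fibre of `w` is a closed upper set. By
`ClosedUpper.le_of_inter` a relation in the fibre sees only the trace of an open set there, so
agreement with a stream map `g` on that fibre is enough. -/
theorem IsStream.of_fibers {T : Type*} [TopologicalSpace T] [T1Space T] {f : X → Y}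
    (hf : Continuous f) {w : X → T} (hw : IsTime w)
    (h : ∀ c, ∃ g : X → Y, IsStream g ∧ ∀ x, w x = c → f x = g x) : IsStream f := by
  refine ⟨hf, fun {V U x y} hxy hV => ?_⟩
  obtain ⟨g, hg, hfg⟩ := h (w x)
  have hxy' := ClosedUpper.le_of_inter (C := hw.closedUpper (isClosed_singleton (x := w x)))
    (V' := U.comap ⟨g, hg.continuous⟩) (fun z hz hzw => by
      have := hV z hz
      rwa [hfg z hzw] at this) hxy rfl
  rw [hfg x rfl, hfg y (hw.eq (X.circ.mono le_top hxy)).symm]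
  exact hg.mono hxy' fun _ hz => hz

/-! ### Cylinders -/

theorem IsStream.fst : IsStream (X := cyl X) fun p => p.1 := (cylProj X).isStream

theorem IsStream.slice (t : unitInterval) : IsStream (Y := cyl X) fun x => (x, t) :=
  (cylIncl t X).isStream

theorem IsStream.prodMk {f : X → Y} (hf : IsStream f) {w : X → unitInterval} (hw : IsTime w) :
    IsStream (Y := cyl Y) fun x => (f x, w x) :=
  of_fibers (hf.continuous.prodMk hw.continuous) hw fun c =>
    ⟨fun x => (f x, c), (IsStream.slice c).comp hf, fun x hx => by rw [hx]⟩

/-- The nearest point of the unit interval. -/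
noncomputable def clamp (r : ℝ) : unitInterval := Set.projIcc 0 1 zero_le_one r

@[fun_prop]
theorem continuous_clamp : Continuous clamp := continuous_projIcc (h := zero_le_one)

@[simp] theorem clamp_coe (t : unitInterval) : clamp t = t := Set.projIcc_val _ t

theorem clamp_of_nonpos {r : ℝ} (h : r ≤ 0) : clamp r = 0 := Set.projIcc_of_le_left _ h

theorem clamp_of_one_le {r : ℝ} (h : 1 ≤ r) : clamp r = 1 := Set.projIcc_of_right_le _ h

theorem coe_clamp {r : ℝ} (h₀ : 0 ≤ r) (h₁ : r ≤ 1) : (clamp r : ℝ) = r :=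
  congrArg Subtype.val (Set.projIcc_of_mem zero_le_one ⟨h₀, h₁⟩)

@[simp] theorem clamp_zero : clamp 0 = 0 := clamp_of_nonpos le_rfl

@[simp] theorem clamp_one : clamp 1 = 1 := clamp_of_one_le le_rfl

/-- The fraction `t / s` of the unit interval, truncated at `1`. -/
noncomputable def ratio (t s : unitInterval) : unitInterval := clamp (t / max (t : ℝ) s)

-- For `s = 0` this rests on the convention `0 / 0 = 0`.
@[simp] theorem ratio_zero (s : unitInterval) : ratio 0 s = 0 := by simp [ratio]

theorem ratio_of_le {t s : unitInterval} (h : s ≤ t) (ht : t ≠ 0) : ratio t s = 1 := by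
  have h' : (s : ℝ) ≤ t := h
  have ht' : (t : ℝ) ≠ 0 := fun h0 => ht (Subtype.ext h0)
  rw [ratio, max_eq_left h', div_self ht', clamp_one]

theorem continuousAt_ratio {p : unitInterval × unitInterval} (h : p.1 ≠ 0 ∨ p.2 ≠ 0) :
    ContinuousAt (fun p : unitInterval × unitInterval => ratio p.1 p.2) p := by
  unfold ratio
  refine continuous_clamp.continuousAt.comp (ContinuousAt.div (by fun_prop) (by fun_prop) ?_)
  have : 0 < max (p.1 : ℝ) p.2 := by
    rcases h with h | h
    · exact lt_max_of_lt_left (unitInterval.pos_iff_ne_zero.2 h)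
    · exact lt_max_of_lt_right (unitInterval.pos_iff_ne_zero.2 h)
  exact this.ne'

/-- A homotopy that is constant where `w` vanishes may be run at speed `1 / w`. -/
theorem IsStream.slowdown {f : cyl X → Y} (hf : IsStream f) {w : X → unitInterval}
    (hw : IsTime w) (h : ∀ x, w x = 0 → ∀ t, f (x, t) = f (x, 0)) :
    IsStream (X := cyl X) fun p => f (p.1, ratio p.2 (w p.1)) := by
  have hw' : Continuous fun p : X × unitInterval => (p.2, w p.1) :=
    continuous_snd.prodMk (hw.continuous.comp continuous_fst)
  have hf' : Continuous fun p : X × unitInterval => f p := hf.continuous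
  refine of_fibers (w := fun p : cyl X => p.2) ?_ IsTime.snd fun t => ?_
  · change Continuous fun p : X × unitInterval => f (p.1, ratio p.2 (w p.1))
    rw [continuous_iff_continuousAt]
    rintro ⟨x, t⟩
    by_cases hxt : t ≠ 0 ∨ w x ≠ 0
    · have h1 : ContinuousAt (fun p : X × unitInterval => (p.1, ratio p.2 (w p.1))) (x, t) :=
        continuousAt_fst.prodMk
          (ContinuousAt.comp (f := fun p : X × unitInterval => (p.2, w p.1)) (x := (x, t))
            (continuousAt_ratio (p := (t, w x)) hxt) hw'.continuousAt)
      exact ContinuousAt.comp (f := fun p : X × unitInterval => (p.1, ratio p.2 (w p.1)))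
        (g := fun p : X × unitInterval => f p) hf'.continuousAt h1
    -- At time `0` over a zero of `w` the ratio is discontinuous. There `f` sends all of `{x} × 𝕀`
    -- to one point, and compactness of `𝕀` gives a neighbourhood of `x` controlling all times at
    -- once.
    · push Not at hxt
      obtain ⟨rfl, hx⟩ := hxt
      intro U hU
      have h0 : f (x, ratio 0 (w x)) = f (x, 0) := by rw [ratio_zero]
      have h1 : ∀ᶠ z in nhds x, ∀ s ∈ (Set.univ : Set unitInterval), f (z, s) ∈ U := by
        refine isCompact_univ.eventually_forall_of_forall_eventually (x₀ := x)
          (P := fun z s => f (z, s) ∈ U) fun s _ => ?_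
        refine hf'.continuousAt (x := (x, s)) ?_
        rw [h x hx s, ← h0]
        exact hU
      exact (continuousAt_fst (p := (x, (0 : unitInterval)))).eventually h1 |>.mono
        fun p hp => hp _ trivial
  -- At fixed time `t` the ratio is identically `0` if `t = 0` and continuous in `w` otherwise, so
  -- each time fibre agrees with a stream map.
  · by_cases ht : t = 0
    · subst ht
      refine ⟨fun p => f (p.1, 0), hf.comp ((IsStream.slice 0).comp IsStream.fst), ?_⟩
      rintro ⟨x, t⟩ (rfl : t = 0)
      simp
    · refine ⟨fun p => f (p.1, ratio t (w p.1)), ?_, by rintro ⟨x, t⟩ rfl; rfl⟩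
      refine hf.comp (IsStream.fst.prodMk ?_)
      refine (hw.comp (θ := fun s => ratio t s) ?_).comp_isStream IsStream.fst
      exact continuous_iff_continuousAt.2 fun s =>
        ContinuousAt.comp (f := fun s : unitInterval => (t, s)) (x := s)
          (continuousAt_ratio (p := (t, s)) (Or.inl ht)) (by fun_prop)

end CircSpace

/-! ### Maps of diagrams from functions -/

namespace DiagStream

open CircSpace

variable {G : Type u} [SmallCategory G] {X Y Z : G ⥤ KStream.{u}}

/-- The value of a map of diagrams at a point. -/
def ev (f : Y ⟶ Z) (o : G) (y : Y.obj o) : Z.obj o := (f.app o).hom.map y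

/-- The pair `(y, t)` as a point of the cylinder. -/
def cylMk {o : G} (y : Y.obj o) (t : unitInterval) : (cyl Y).obj o :=
  ((y, t) : Y.obj o × unitInterval)

/-- The value of a path at a time. -/
def pathAt {o : G} (γ : (path Z).obj o) (t : unitInterval) : Z.obj o :=
  DFunLike.coe (F := C(unitInterval, Z.obj o)) γ t

theorem pathAt_ext {o : G} {γ γ' : (path Z).obj o} (h : ∀ t, pathAt γ t = pathAt γ' t) : γ = γ' :=
  ContinuousMap.ext h

/-- The value of a map from a cylinder at a point. -/
def hv (h : cyl Y ⟶ Z) (o : G) (y : Y.obj o) (t : unitInterval) : Z.obj o :=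
  ev h o (cylMk y t)

/-- The action of a diagram on points. -/
def act (Y : G ⥤ KStream.{u}) {o o' : G} (g : o ⟶ o') (y : Y.obj o) : Y.obj o' :=
  (Y.map g).hom.map y

theorem isStream_ev (f : Y ⟶ Z) (o : G) :
    IsStream (X := (Y.obj o).obj) (Y := (Z.obj o).obj) (ev f o) :=
  (f.app o).hom.isStream

theorem isStream_hv (h : cyl Y ⟶ Z) (o : G) :
    IsStream (X := CircSpace.cyl (Y.obj o).obj) (Y := (Z.obj o).obj) fun p => hv h o p.1 p.2 :=
  (h.app o).hom.isStream

theorem isStream_cylMk (o : G) : IsStream (X := CircSpace.cyl (Y.obj o).obj)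
    (Y := ((cyl Y).obj o).obj) fun p => cylMk (Y := Y) p.1 p.2 := IsStream.id

theorem isStream_act (Y : G ⥤ KStream.{u}) {o o' : G} (g : o ⟶ o') :
    IsStream (X := (Y.obj o).obj) (Y := (Y.obj o').obj) (act Y g) :=
  (Y.map g).hom.isStream

theorem act_id (Y : G ⥤ KStream.{u}) (o : G) (y : Y.obj o) : act Y (𝟙 o) y = y := by
  unfold act
  rw [Y.map_id]
  rfl

theorem act_comp (Y : G ⥤ KStream.{u}) {o o' o'' : G} (g : o ⟶ o') (g' : o' ⟶ o'') (y : Y.obj o) :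
    act Y (g ≫ g') y = act Y g' (act Y g y) := by
  unfold act
  rw [Y.map_comp]
  rfl

theorem ev_act (f : Y ⟶ Z) {o o' : G} (g : o ⟶ o') (y : Y.obj o) :
    ev f o' (act Y g y) = act Z g (ev f o y) :=
  congrArg (fun k : Y.obj o ⟶ Z.obj o' => k.hom.map y) (f.naturality g)

theorem hv_act (h : cyl Y ⟶ Z) {o o' : G} (g : o ⟶ o') (y : Y.obj o) (t : unitInterval) :
    hv h o' (act Y g y) t = act Z g (hv h o y t) :=
  ev_act h g (cylMk y t)

theorem ext_ev {f g : Y ⟶ Z} (h : ∀ o y, ev f o y = ev g o y) : f = g :=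
  NatTrans.ext (funext fun o => ObjectProperty.hom_ext _ (CircSpace.hom_ext (h o)))

theorem ext_hv {f g : cyl Y ⟶ Z} (h : ∀ o y t, hv f o y t = hv g o y t) : f = g :=
  ext_ev fun o (p : Y.obj o × unitInterval) => h o p.1 p.2

@[simp] theorem ev_comp (f : X ⟶ Y) (g : Y ⟶ Z) (o : G) (x : X.obj o) :
    ev (f ≫ g) o x = ev g o (ev f o x) := rfl

@[simp] theorem ev_id (o : G) (x : X.obj o) : ev (𝟙 X) o x = x := rfl

@[simp] theorem ev_cylIncl (t : unitInterval) (h : cyl Y ⟶ Z) (o : G) (y : Y.obj o) :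
    ev h o (ev (cylIncl t Y) o y) = hv h o y t := rfl

@[simp] theorem hv_comp (h : cyl X ⟶ Y) (g : Y ⟶ Z) (o : G) (x : X.obj o) (t : unitInterval) :
    hv (h ≫ g) o x t = ev g o (hv h o x t) := rfl

@[simp] theorem hv_cylMap (f : X ⟶ Y) (h : cyl Y ⟶ Z) (o : G) (x : X.obj o) (t : unitInterval) :
    hv (cylMap f ≫ h) o x t = hv h o (ev f o x) t := rfl

@[simp] theorem hv_cylProj (f : X ⟶ Y) (o : G) (x : X.obj o) (t : unitInterval) :
    hv (cylProj X ≫ f) o x t = ev f o x := rfl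

theorem ev_congr {f g : Y ⟶ Z} (h : f = g) (o : G) (y : Y.obj o) : ev f o y = ev g o y := by
  rw [h]

theorem hv_congr {f g : cyl Y ⟶ Z} (h : f = g) (o : G) (y : Y.obj o) (t : unitInterval) :
    hv f o y t = hv g o y t := by
  rw [h]

/-- Stated as an existence, so that the maps built from it are known only through their values on
points. -/
theorem exists_hom (F : ∀ o, Y.obj o → Z.obj o)
    (hF : ∀ o, IsStream (X := (Y.obj o).obj) (Y := (Z.obj o).obj) (F o))
    (nat : ∀ {o o'} (g : o ⟶ o') (y : Y.obj o), F o' (act Y g y) = act Z g (F o y)) :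
    ∃ f : Y ⟶ Z, ∀ o y, ev f o y = F o y :=
  ⟨{ app := fun o => ObjectProperty.homMk (hF o).hom
     naturality := fun _ _ g => ObjectProperty.hom_ext _ (CircSpace.hom_ext (nat g)) },
    fun _ _ => rfl⟩

theorem exists_cyl_hom (F : ∀ o, Y.obj o → unitInterval → Z.obj o)
    (hF : ∀ o, IsStream (X := CircSpace.cyl (Y.obj o).obj) (Y := (Z.obj o).obj)
      fun p => F o p.1 p.2)
    (nat : ∀ {o o'} (g : o ⟶ o') (y : Y.obj o) t, F o' (act Y g y) t = act Z g (F o y t)) :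
    ∃ h : cyl Y ⟶ Z, ∀ o y t, hv h o y t = F o y t := by
  obtain ⟨f, hf⟩ := exists_hom (Y := cyl Y) (Z := Z)
    (fun o (p : Y.obj o × unitInterval) => F o p.1 p.2) hF
    fun g (p : Y.obj _ × unitInterval) => nat g p.1 p.2
  exact ⟨f, fun o y t => hf o _⟩

theorem exists_cyl_cyl_hom (F : ∀ o, Y.obj o → unitInterval → unitInterval → Z.obj o)
    (hF : ∀ o, IsStream (X := CircSpace.cyl (CircSpace.cyl (Y.obj o).obj)) (Y := (Z.obj o).obj)
      fun p => F o p.1.1 p.1.2 p.2)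
    (nat : ∀ {o o'} (g : o ⟶ o') (y : Y.obj o) s t, F o' (act Y g y) s t = act Z g (F o y s t)) :
    ∃ h : cyl (cyl Y) ⟶ Z, ∀ o y s t, hv h o (cylMk y s) t = F o y s t := by
  obtain ⟨f, hf⟩ := exists_cyl_hom (Y := cyl Y) (Z := Z)
    (fun o (p : Y.obj o × unitInterval) => F o p.1 p.2) hF
    fun g (p : Y.obj _ × unitInterval) => nat g p.1 p.2
  exact ⟨f, fun o y s t => hf o _ _⟩

/-! ### Paths and homotopy extension -/

theorem exists_curry (h : cyl Y ⟶ Z) : ∃ k : Y ⟶ path Z, ∀ o y t,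
    pathAt (ev k o y) t = hv h o y t :=
  ⟨{ app := fun o => ObjectProperty.homMk (curry (Y.obj o).property.1.isCompactlyFinal (h.app o).hom)
     naturality := fun o o' g => by
      refine ObjectProperty.hom_ext _ (CircSpace.hom_ext fun y => ?_)
      exact ContinuousMap.ext fun t => hv_act h g y t }, fun _ _ _ => rfl⟩

theorem exists_uncurry (k : Y ⟶ path Z) : ∃ h : cyl Y ⟶ Z, ∀ o y t,
    hv h o y t = pathAt (ev k o y) t := by
  refine exists_cyl_hom (fun o y t => pathAt (ev k o y) t)
    (fun o => (CircSpace.cylMap (k.app o).hom ≫ pathEv (Z.obj o).obj).isStream) fun g y t => ?_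
  exact congrArg (fun γ : C(unitInterval, Z.obj _) => γ t) (ev_act k g y)

theorem ext_path {f g : Y ⟶ path Z} (h : ∀ o y t,
    pathAt (ev f o y) t =
      pathAt (ev g o y) t) : f = g :=
  ext_ev fun o y => pathAt_ext (h o y)

theorem ev_pathEval (k : Y ⟶ path Z) (t : unitInterval) (o : G) (y : Y.obj o) :
    ev (pathEval t Z) o (ev k o y) = pathAt (ev k o y) t := rfl

/-- The homotopy extension property in terms of cylinders. -/
theorem isHCofibration_iff (e : X ⟶ Y) : IsHCofibration e ↔
    ∀ (E : G ⥤ KStream.{u}) (a : Y ⟶ E) (h : cyl X ⟶ E), (∀ o x, hv h o x 0 = ev a o (ev e o x)) →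
      ∃ k : cyl Y ⟶ E, (∀ o y, hv k o y 0 = ev a o y) ∧
        ∀ o x t, hv k o (ev e o x) t = hv h o x t := by
  constructor
  · intro he E a h hah
    obtain ⟨h', hh'⟩ := exists_curry h
    have sq : CommSq h' e (pathEval 0 E) a := ⟨ext_ev fun o x => by
      rw [ev_comp, ev_pathEval, hh', hah, ev_comp]⟩
    have := (he E).sq_hasLift sq
    obtain ⟨k, hk⟩ := exists_uncurry sq.lift
    refine ⟨k, fun o y => ?_, fun o x t => ?_⟩
    · rw [hk, ← ev_pathEval, ← ev_comp, sq.fac_right]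
    · rw [hk, ← hh', ← ev_comp, sq.fac_left]
  · intro he E
    refine ⟨fun {f g} sq => ?_⟩
    obtain ⟨h, hh⟩ := exists_uncurry f
    obtain ⟨k, hk₀, hk⟩ := he E g h fun o x => by
      rw [hh, ← ev_pathEval, ← ev_comp, sq.w, ev_comp]
    obtain ⟨k', hk'⟩ := exists_curry k
    refine ⟨⟨⟨k', ext_path fun o x t => ?_, ext_ev fun o y => ?_⟩⟩⟩
    · rw [ev_comp, hk', hk, hh]
    · rw [ev_comp, ev_pathEval, hk', hk₀]

/-- The covering homotopy property. -/
theorem isHFibration_iff {E B : G ⥤ KStream.{u}} (p : E ⟶ B) : IsHFibration p ↔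
    ∀ (A : G ⥤ KStream.{u}) (a : A ⟶ E) (h : cyl A ⟶ B), (∀ o x, hv h o x 0 = ev p o (ev a o x)) →
      ∃ k : cyl A ⟶ E, (∀ o x, hv k o x 0 = ev a o x) ∧
        ∀ o x t, ev p o (hv k o x t) = hv h o x t := by
  constructor
  · intro hp A a h hah
    have sq : CommSq a (cylIncl 0 A) p h := ⟨ext_ev fun o x => by
      rw [ev_comp, ev_comp, ev_cylIncl, hah]⟩
    have := (hp A).sq_hasLift sq
    refine ⟨sq.lift, fun o x => ?_, fun o x t => ?_⟩
    · rw [← ev_cylIncl, ← ev_comp, sq.fac_left]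
    · rw [← hv_comp, sq.fac_right]
  · intro hp A
    refine ⟨fun {f g} sq => ?_⟩
    obtain ⟨k, hk₀, hk⟩ := hp A f g fun o x => by
      rw [← ev_comp, sq.w]; rfl
    exact ⟨⟨⟨k, ext_ev hk₀, ext_hv hk⟩⟩⟩

theorem homotopic_iff {f g : Y ⟶ Z} : Homotopic f g ↔
    ∃ h : cyl Y ⟶ Z, (∀ o y, hv h o y 0 = ev f o y) ∧ ∀ o y, hv h o y 1 = ev g o y :=
  exists_congr fun _ => and_congr
    ⟨fun e o y => ev_congr e o y, fun e => ext_ev e⟩ ⟨fun e o y => ev_congr e o y, fun e => ext_ev e⟩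

theorem exists_reverse (h : cyl Y ⟶ Z) : ∃ k : cyl Y ⟶ Z, ∀ o y t,
    hv k o y t = hv h o y (unitInterval.symm t) :=
  exists_cyl_hom (fun o y t => hv h o y (unitInterval.symm t))
    (fun o => (isStream_hv h o).comp
      (IsStream.fst.prodMk (IsTime.snd.comp unitInterval.continuous_symm)))
    fun g y _ => hv_act h g y _

theorem exists_concat (h k : cyl Y ⟶ Z) (hk : ∀ o y, hv h o y 1 = hv k o y 0) :
    ∃ l : cyl Y ⟶ Z, ∀ o y (t : unitInterval), hv l o y t =
      if (t : ℝ) ≤ 1 / 2 then hv h o y (clamp (2 * t)) else hv k o y (clamp (2 * t - 1)) := by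
  refine exists_cyl_hom _ (fun o => ?_) fun g y t => ?_
  · refine IsStream.ite (X := CircSpace.cyl (Y.obj o).obj) (w := fun p => (p.2 : ℝ))
      (w' := fun _ => 1 / 2)
      ((isStream_hv h o).comp (IsStream.fst.prodMk
        (IsTime.snd.comp (θ := fun t => clamp (2 * t)) (by fun_prop))))
      ((isStream_hv k o).comp (IsStream.fst.prodMk
        (IsTime.snd.comp (θ := fun t => clamp (2 * t - 1)) (by fun_prop))))
      (IsTime.snd.comp (θ := fun t => (t : ℝ)) (by fun_prop))
      (IsTime.snd.comp (θ := fun _ => 1 / 2) (by fun_prop)) ?_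
    intro p hp
    have hp' : (p.2 : ℝ) = 1 / 2 := hp
    have h1 : (2 : ℝ) * (p.2 : ℝ) = 1 := by rw [hp']; norm_num
    simp only [h1, sub_self, clamp_one, clamp_zero]
    exact hk o _
  · split_ifs
    · exact hv_act h g y _
    · exact hv_act k g y _

end DiagStream

namespace DiagStream

open CircSpace

variable {G : Type u} [SmallCategory G] {X Y Z : G ⥤ KStream.{u}}

/-! ### Evaluation of paths is an acyclic fibration -/

theorem exists_const_homotopy (f : Y ⟶ Z) : ∃ h : cyl Y ⟶ Z, ∀ o y t, hv h o y t = ev f o y :=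
  ⟨cylProj Y ≫ f, fun _ _ _ => rfl⟩

/-- At homotopy time `s` the lifted path runs `h` backwards from time `s` to `0` during `[0, s]`,
then follows the given path, whose tail is cut off. -/
theorem isHFibration_pathEval (E : G ⥤ KStream.{u}) : IsHFibration (pathEval 0 E) := by
  rw [isHFibration_iff]
  intro A a h hah
  obtain ⟨α, hα⟩ := exists_uncurry a
  have hα₀ : ∀ o x, hv α o x 0 = hv h o x 0 := fun o x => by rw [hα, hah, ev_pathEval]
  obtain ⟨Φ, hΦ⟩ := exists_cyl_cyl_hom (Y := A) (Z := E)
    (fun o x s t => if (t : ℝ) ≤ s then hv h o x (clamp (s - t)) else hv α o x (clamp (t - s)))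
    (fun o => by
      have hs : IsTime (X := CircSpace.cyl (CircSpace.cyl (A.obj o).obj))
        fun p => (p.1.2 : ℝ) := (IsTime.snd.comp continuous_subtype_val).comp_isStream IsStream.fst
      have ht : IsTime (X := CircSpace.cyl (CircSpace.cyl (A.obj o).obj))
        fun p => (p.2 : ℝ) := IsTime.snd.comp continuous_subtype_val
      refine IsStream.ite (X := CircSpace.cyl (CircSpace.cyl (A.obj o).obj))
        ((isStream_hv h o).comp ((IsStream.fst.comp IsStream.fst).prodMk
          (hs.comp₂ ht (θ := fun s t => clamp (s - t)) (by fun_prop))))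
        ((isStream_hv α o).comp ((IsStream.fst.comp IsStream.fst).prodMk
          (ht.comp₂ hs (θ := fun s t => clamp (s - t)) (by fun_prop)))) ht hs ?_
      intro p hp
      have hp' : (p.2 : ℝ) = p.1.2 := hp
      simp only [hp', sub_self, clamp_zero]
      exact (hα₀ o _).symm)
    fun g x s t => by
      split_ifs
      · exact hv_act h g x _
      · exact hv_act α g x _
  obtain ⟨k, hk⟩ := exists_curry Φ
  refine ⟨k, fun o x => pathAt_ext fun t => ?_, fun o x s => ?_⟩
  · refine (hk o (cylMk x 0) t).trans ((hΦ o x 0 t).trans ?_)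
    rw [← hα]
    split_ifs with ht
    · have ht0 : t = 0 := le_antisymm ht t.2.1
      subst ht0
      simp [hα₀]
    · simp
  · refine (hk o (cylMk x s) 0).trans ((hΦ o x s 0).trans ?_)
    rw [if_pos (show ((0 : unitInterval) : ℝ) ≤ s from s.2.1)]
    simp

/-- The inverse sends a point to its constant path; the paths `t ↦ γ (s t)` shrink `γ` to its
starting point. -/
theorem isHAcyclic_pathEval (E : G ⥤ KStream.{u}) : IsHAcyclic (pathEval 0 E) := by
  obtain ⟨c, hc⟩ := exists_const_homotopy (𝟙 E)
  obtain ⟨g, hg⟩ := exists_curry c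
  have hgp : g ≫ pathEval 0 E = 𝟙 E := ext_ev fun o y => by
    rw [ev_comp, ev_pathEval, hg, hc]
  refine ⟨g, homotopic_iff.2 ?_, homotopic_iff.2 ?_⟩
  · obtain ⟨ε, hε⟩ := exists_uncurry (𝟙 (path E))
    obtain ⟨Φ, hΦ⟩ := exists_cyl_cyl_hom (Y := path E) (Z := E)
      (fun o γ s t => hv ε o γ (s * t))
      (fun o => (isStream_hv ε o).comp ((IsStream.fst.comp IsStream.fst).prodMk
        ((IsTime.snd.comp_isStream IsStream.fst).comp₂ IsTime.snd (by fun_prop))))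
      fun g γ s t => hv_act ε g γ _
    obtain ⟨h, hh⟩ := exists_curry Φ
    refine ⟨h, fun o γ => pathAt_ext fun t => ?_, fun o γ => pathAt_ext fun t => ?_⟩
    · refine (hh o (cylMk γ 0) t).trans ((hΦ o γ 0 t).trans ?_)
      rw [ev_comp, hg, hc, zero_mul, hε]
      rfl
    · refine (hh o (cylMk γ 1) t).trans ((hΦ o γ 1 t).trans ?_)
      rw [one_mul, hε, ev_id]
  · rw [hgp]
    exact ⟨c, fun o y => hc o y 0, fun o y => hc o y 1⟩

/-! ### Heights and sublevels -/

/-- The value of a map to the interval. -/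
def height (w : Y ⟶ interval G) (o : G) (y : Y.obj o) : unitInterval :=
  ULift.down (α := unitInterval) ((w.app o).hom.map y)

theorem isTime_height (w : Y ⟶ interval G) (o : G) :
    IsTime (X := (Y.obj o).obj) (height w o) :=
  (IsTime.of_hom (T := ULift.{u} unitInterval) (w.app o).hom).comp continuous_uliftDown

theorem height_act (w : Y ⟶ interval G) {o o' : G} (g : o ⟶ o') (y : Y.obj o) :
    height w o' (act Y g y) = height w o y :=
  congrArg (fun z : ULift.{u} unitInterval => z.down) (ev_act w g y)

@[simp] theorem height_comp (f : X ⟶ Y) (w : Y ⟶ interval G) (o : G) (x : X.obj o) :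
    height (f ≫ w) o x = height w o (ev f o x) := rfl

theorem ext_height {w w' : Y ⟶ interval G} (h : ∀ o y, height w o y = height w' o y) : w = w' :=
  ext_ev fun o y => ULift.ext _ _ (h o y)

theorem exists_height (F : ∀ o, Y.obj o → unitInterval)
    (hF : ∀ o, IsTime (X := (Y.obj o).obj) (F o))
    (nat : ∀ {o o'} (g : o ⟶ o') (y : Y.obj o), F o' (act Y g y) = F o y) :
    ∃ w : Y ⟶ interval G, ∀ o y, height w o y = F o y := by
  obtain ⟨w, hw⟩ := exists_hom (Y := Y) (Z := interval G) (fun o y => ULift.up (F o y))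
    (fun o => ((hF o).comp continuous_uliftUp).isStream) fun g y => congrArg ULift.up (nat g y)
  exact ⟨w, fun o y => congrArg (fun z : ULift.{u} unitInterval => z.down) (hw o y)⟩

theorem exists_graph (h : cyl Y ⟶ Z) (w : Y ⟶ interval G) :
    ∃ f : Y ⟶ Z, ∀ o y, ev f o y = hv h o y (height w o y) :=
  exists_hom _ (fun o => (isStream_hv h o).comp (IsStream.id.prodMk (isTime_height w o)))
    fun g y => by rw [height_act, hv_act]

theorem exists_slowdown (h : cyl Y ⟶ Z) (w : Y ⟶ interval G)
    (hw : ∀ o y, height w o y = 0 → ∀ t, hv h o y t = hv h o y 0) :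
    ∃ k : cyl Y ⟶ Z, ∀ o y t, hv k o y t = hv h o y (ratio t (height w o y)) :=
  exists_cyl_hom _ (fun o => (isStream_hv h o).slowdown (isTime_height w o) (hw o))
    fun g y t => by rw [height_act, hv_act]

/-- The subdiagram on which a map to the interval is at most `c`. -/
def sublevel (w : Y ⟶ interval G) (c : unitInterval) : G ⥤ KStream.{u} where
  obj o := ⟨((isTime_height w o).closedUpper (isClosed_Iic (a := c))).sub,
    (ClosedUpper.isCompactlyFinal_sub _ (Y.obj o).property.1.isCompactlyFinal).isKStream,
    ClosedUpper.isWeakHausdorff_sub _ (Y.obj o).property.2⟩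
  map {o o'} g := ObjectProperty.homMk (ClosedUpper.isStream_codRestrict
    (C := (isTime_height w o').closedUpper (isClosed_Iic (a := c)))
    ((isStream_act Y g).comp (ClosedUpper.isStream_val _)) fun y => by
      change height w o' (act Y g y.1) ≤ c
      rw [height_act]
      exact y.2).hom
  map_id o := ObjectProperty.hom_ext _ (CircSpace.hom_ext fun y => Subtype.ext (act_id Y o y.1))
  map_comp g g' := ObjectProperty.hom_ext _ (CircSpace.hom_ext fun y =>
    Subtype.ext (act_comp Y g g' y.1))

/-- A point of a sublevel. -/
def sublevelMk {w : Y ⟶ interval G} {c : unitInterval} {o : G} (y : Y.obj o)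
    (hy : height w o y ≤ c) : (sublevel w c).obj o :=
  (⟨y, hy⟩ : {y // height w o y ≤ c})

theorem act_sublevelMk {w : Y ⟶ interval G} {c : unitInterval} {o o' : G} (g : o ⟶ o')
    (y : Y.obj o) (hy : height w o y ≤ c) :
    act (sublevel w c) g (sublevelMk y hy) =
      sublevelMk (act Y g y) ((height_act w g y).trans_le hy) := rfl

theorem exists_sublevel_incl (w : Y ⟶ interval G) (c : unitInterval) :
    ∃ i : sublevel w c ⟶ Y, ∀ o (y : Y.obj o) (hy : height w o y ≤ c),
      ev i o (sublevelMk y hy) = y := by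
  obtain ⟨i, hi⟩ := exists_hom (Y := sublevel w c) (Z := Y)
    (fun o (y : {y // height w o y ≤ c}) => y.1)
    (fun o => ClosedUpper.isStream_val ((isTime_height w o).closedUpper (isClosed_Iic (a := c))))
    fun _ _ => rfl
  exact ⟨i, fun o y hy => hi o _⟩

theorem exists_sublevel_lift (w : Y ⟶ interval G) (c : unitInterval) (f : Z ⟶ Y)
    (hf : ∀ o z, height w o (ev f o z) ≤ c) :
    ∃ l : Z ⟶ sublevel w c, ∀ o z, ev l o z = sublevelMk (ev f o z) (hf o z) :=
  exists_hom (fun o z => sublevelMk (ev f o z) (hf o z))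
    (fun o => ClosedUpper.isStream_codRestrict
      (C := (isTime_height w o).closedUpper (isClosed_Iic (a := c))) (isStream_ev f o) (hf o))
    fun g z => Subtype.ext (ev_act f g z)

theorem comp_eq_zero_iff_height {e : X ⟶ Y} {w : Y ⟶ interval G} :
    e ≫ w = toPoint X ≫ zero G ↔ ∀ o x, height w o (ev e o x) = 0 :=
  ⟨fun h o x => by rw [← height_comp, h]; rfl, fun h => ext_height fun o x => h o x⟩

theorem exists_lift_of_isPullback {e : X ⟶ Y} {w : Y ⟶ interval G}
    (h : IsPullback e (toPoint X) w (zero G)) (f : Z ⟶ Y) (hf : ∀ o z, height w o (ev f o z) = 0) :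
    ∃ l : Z ⟶ X, ∀ o z, ev e o (ev l o z) = ev f o z :=
  ⟨h.lift f (toPoint Z) (comp_eq_zero_iff_height.2 hf), fun o z => by
    rw [← ev_comp, h.lift_fst]⟩

/-- A point of `Y.obj o` is in general not a subdiagram, so the pullback property is tested on the
whole zero set of `w`, a diagram of streams in its own right. -/
theorem exists_of_height_eq_zero {e : X ⟶ Y} {w : Y ⟶ interval G}
    (h : IsPullback e (toPoint X) w (zero G)) {o : G} {y : Y.obj o} (hy : height w o y = 0) :
    ∃ x, ev e o x = y := by
  obtain ⟨i, hi⟩ := exists_sublevel_incl w 0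
  have hi₀ : ∀ (o : G) (z : {y // height w o y ≤ 0}), height w o (ev i o z) = 0 := fun o z =>
    (congrArg (height w o) (hi o z.1 z.2)).trans (le_antisymm z.2 (height w o z.1).2.1)
  obtain ⟨l, hl⟩ := exists_lift_of_isPullback h i hi₀
  exact ⟨_, (hl o (sublevelMk y hy.le)).trans (hi o y hy.le)⟩

/-- The corestriction of `e` to the zero set of `w` has a left inverse, namely the lift of the
inclusion of that zero set. -/
theorem injective_of_isPullback {e : X ⟶ Y} {w : Y ⟶ interval G}
    (h : IsPullback e (toPoint X) w (zero G)) {o : G} {x x' : X.obj o} (hx : ev e o x = ev e o x') :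
    x = x' := by
  have he := comp_eq_zero_iff_height.1 h.w
  obtain ⟨i, hi⟩ := exists_sublevel_incl w 0
  have hi₀ : ∀ (o : G) (z : {y // height w o y ≤ 0}), height w o (ev i o z) = 0 := fun o z =>
    (congrArg (height w o) (hi o z.1 z.2)).trans (le_antisymm z.2 (height w o z.1).2.1)
  obtain ⟨l, hl⟩ := exists_lift_of_isPullback h i hi₀
  obtain ⟨e', he'⟩ := exists_sublevel_lift w 0 e fun o x => (he o x).le
  have hel : e' ≫ l = 𝟙 X := h.hom_ext
    (ext_ev fun o x => by rw [ev_comp, ev_comp, hl, he', hi]; rfl)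
    (ext_ev fun o x => rfl)
  have h1 : ∀ x, ev l o (ev e' o x) = x := ev_congr hel o
  have h2 : ev e' o x = ev e' o x' := by
    rw [he', he']
    exact Subtype.ext hx
  rw [← h1 x, h2, h1 x']

end DiagStream

namespace DiagStream

open CircSpace

variable {G : Type u} [SmallCategory G] {X Y Z : G ⥤ KStream.{u}}

/-! ### Acyclic fibrations are shrinkable -/

variable {E B : G ⥤ KStream.{u}} {p : E ⟶ B}

/-- Lift the homotopy from `p g` to the identity, starting at a homotopy inverse `g`: its end is a
strict section `s`, homotopic to `g`. Hence the identity is homotopic to `g p` and then to `s p`. -/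
theorem exists_section (hf : IsHFibration p) (ha : IsHAcyclic p) :
    ∃ (s : B ⟶ E) (k : cyl E ⟶ E), (∀ o b, ev p o (ev s o b) = b) ∧
      (∀ o x, hv k o x 0 = x) ∧ ∀ o x, hv k o x 1 = ev s o (ev p o x) := by
  obtain ⟨g, h₁, h₂⟩ := ha
  obtain ⟨h, h0, h1⟩ := homotopic_iff.1 h₁
  obtain ⟨k, k0, k1⟩ := homotopic_iff.1 h₂
  obtain ⟨l, l0, hl⟩ := (isHFibration_iff p).1 hf B g k fun o x => by rw [k0, ev_comp]
  obtain ⟨h', hh'⟩ := exists_reverse h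
  obtain ⟨m, hm⟩ := exists_concat h' (cylMap p ≫ l) fun o y => by
    rw [hh', unitInterval.symm_one, h0, hv_cylMap, l0, ev_comp]
  refine ⟨cylIncl 1 B ≫ l, m, fun o b => ?_, fun o x => ?_, fun o x => ?_⟩
  · rw [ev_comp, ev_cylIncl, hl, k1, ev_id]
  · rw [hm, if_pos (by simp), hh']
    simp [h1]
  · rw [hm, if_neg (by norm_num)]
    norm_num
    rfl

/-- The tent function. -/
noncomputable def tent (t : unitInterval) : unitInterval := clamp (min (2 * (t : ℝ)) (2 - 2 * t))

@[fun_prop]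
theorem continuous_tent : Continuous tent := by
  unfold tent
  fun_prop

theorem tent_of_le {t : unitInterval} (h : (t : ℝ) ≤ 1 / 2) : tent t = clamp (2 * t) := by
  rw [tent, min_eq_left (by linarith)]

theorem tent_of_ge {t : unitInterval} (h : 1 / 2 ≤ (t : ℝ)) :
    tent t = unitInterval.symm (clamp (2 * t - 1)) := by
  have := t.2.2
  refine Subtype.ext ?_
  rw [tent, min_eq_right (by linarith), unitInterval.coe_symm_eq,
    coe_clamp (by linarith) (by linarith), coe_clamp (by linarith) (by linarith)]
  ring

@[simp] theorem tent_zero : tent 0 = 0 := by simp [tent]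

@[simp] theorem tent_one : tent 1 = 0 := by simp [tent]

/-- Let `k` deform the identity to `s p`. The path `ρ`, which is `s p k` followed by `k` reversed,
leads from `s p x` to `x`, and `p ρ` is `p k` run forth and back. This loop contracts through `M`,
by shortening the excursion by `τ`; lift the contraction to `N`, starting at `ρ`. -/
theorem exists_vertical (hf : IsHFibration p) (ha : IsHAcyclic p) :
    ∃ (s : B ⟶ E) (k : cyl E ⟶ E), (∀ o b, ev p o (ev s o b) = b) ∧
      (∀ o x, hv k o x 0 = ev s o (ev p o x)) ∧ (∀ o x, hv k o x 1 = x) ∧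
      ∀ o x t, ev p o (hv k o x t) = ev p o x := by
  obtain ⟨s, k, hs, k0, k1⟩ := exists_section hf ha
  obtain ⟨k', hk'⟩ := exists_reverse k
  obtain ⟨ρ, hρ⟩ := exists_concat (k ≫ p ≫ s) k' fun o x => by
    rw [hv_comp, k1, ev_comp, hs, hk', unitInterval.symm_zero, k1]
  obtain ⟨M, hM⟩ := exists_cyl_cyl_hom (Y := E) (Z := B)
    (fun o x t τ => ev p o (hv k o x (clamp ((tent t : ℝ) - τ))))
    (fun o => (isStream_ev p o).comp ((isStream_hv k o).comp
      ((IsStream.fst.comp IsStream.fst).prodMk ((IsTime.snd.comp_isStream IsStream.fst).comp₂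
        IsTime.snd (θ := fun t τ => clamp ((tent t : ℝ) - τ)) (by fun_prop)))))
    fun g x t τ => by rw [hv_act, ev_act]
  have hρM : ∀ o x t, hv M o (cylMk x t) 0 = ev p o (ev ρ o (cylMk x t)) := fun o x t => by
    refine (hM o x t 0).trans (Eq.trans ?_ (congrArg (ev p o) (hρ o x t).symm))
    rw [Set.Icc.coe_zero, sub_zero, clamp_coe]
    split_ifs with ht
    · rw [tent_of_le ht, hv_comp, ev_comp, hs]
    · rw [tent_of_ge (le_of_not_ge ht), hk']
  obtain ⟨N, hN0, hN⟩ := (isHFibration_iff p).1 hf (cyl E) ρ M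
    fun o (x : E.obj o × unitInterval) => hρM o x.1 x.2
  -- Along the curve `τ = tent t` the contraction `M` is constantly `p x`, and the curve begins and
  -- ends at `τ = 0`, where `N` is `ρ`. This avoids lifting relative to the sides of the square.
  obtain ⟨V, hV⟩ := exists_cyl_hom (Y := E) (Z := E)
    (fun o x t => hv N o (cylMk x t) (tent t))
    (fun o => (isStream_hv N o).comp ((isStream_cylMk o).prodMk (IsTime.snd.comp continuous_tent)))
    fun g x t => hv_act N g (cylMk x t) _
  refine ⟨s, V, hs, fun o x => ?_, fun o x => ?_, fun o x t => ?_⟩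
  · rw [hV, tent_zero, hN0]
    refine (hρ o x 0).trans ?_
    rw [if_pos (by simp)]
    simp [k0]
  · rw [hV, tent_one, hN0]
    refine (hρ o x 1).trans ?_
    rw [if_neg (by norm_num), hk']
    norm_num [k0]
  · rw [hV, hN, hM, sub_self, clamp_zero, k0]

/-- Cofibrations whose image is a zero set lift against acyclic fibrations. -/
theorem IsHCofibration.hasLiftingProperty {e : X ⟶ Y} (he : IsHCofibration e)
    (w : Y ⟶ interval G) (hw : ∀ o x, height w o (ev e o x) = 0)
    (hw' : ∀ o y, height w o y = 0 → ∃ x, ev e o x = y)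
    (hf : IsHFibration p) (ha : IsHAcyclic p) : HasLiftingProperty e p := by
  obtain ⟨s, V, hs, V0, V1, hV⟩ := exists_vertical hf ha
  refine ⟨fun {a b} sq => ?_⟩
  have hab : ∀ o x, ev p o (ev a o x) = ev b o (ev e o x) := fun o x => ev_congr sq.w o x
  -- Extend the vertical homotopy from `s p a` to `a` to all of `Y`, starting at `s b`. The end of
  -- `K` restricts to `a` on `X`, but covers `b` only up to the homotopy `p K`, which is constant on
  -- `X`.
  obtain ⟨K, K0, hK⟩ := (isHCofibration_iff e).1 he E (b ≫ s) (cylMap a ≫ V) fun o x => by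
    rw [hv_cylMap, V0, hab, ev_comp]
  have hKe : ∀ o x t, ev p o (hv K o (ev e o x) t) = ev b o (ev e o x) := fun o x t => by
    rw [hK, hv_cylMap, hV, hab]
  obtain ⟨K', hK'⟩ := exists_reverse (K ≫ p)
  -- A lift of a homotopy constant on `X` need not be constant there. Completing the homotopy
  -- already at time `w` allows the lift to be read at time `w`, which is time `0` on `X`.
  obtain ⟨M, hM⟩ := exists_slowdown K' w fun o y hy t => by
    obtain ⟨x, rfl⟩ := hw' o y hy
    rw [hK', hK', hv_comp, hv_comp, hKe, hKe]
  obtain ⟨N, N0, hN⟩ := (isHFibration_iff p).1 hf Y (cylIncl 1 Y ≫ K) M fun o y => by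
    rw [hM, ratio_zero, hK', unitInterval.symm_zero, hv_comp, ev_comp, ev_cylIncl]
  obtain ⟨l, hl⟩ := exists_graph N w
  refine ⟨⟨⟨l, ext_ev fun o x => ?_, ext_ev fun o y => ?_⟩⟩⟩
  · rw [ev_comp, hl, hw, N0, ev_comp, ev_cylIncl, hK, hv_cylMap, V1]
  · rw [ev_comp, hl, hN, hM]
    by_cases hy : height w o y = 0
    · obtain ⟨x, rfl⟩ := hw' o y hy
      rw [hK', hv_comp, hKe]
    · rw [ratio_of_le le_rfl hy, hK', unitInterval.symm_one, hv_comp, K0, ev_comp, hs]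

/-! ### Neighborhood deformation retracts are cofibrations -/

/-- Run the deformation `k` from the identity to `f` so that it ends at time `u' = min (1, 2u)`. On
`u ≤ 1/2` the map `f` factors through `X` by the pullback property, so after time `u'` the homotopy
`h` on `X` can be followed. The bound `1/2` replaces the open set `u < 1` by a closed one, as
pasting requires; where `u > 1/2` the deformation takes all the available time. -/
theorem IsNDR.isHCofibration {e : X ⟶ Y} (he : IsNDR e) : IsHCofibration e := by
  obtain ⟨u, hu, f, ⟨-, k₀, ⟨hk0, hk1⟩, hke⟩, hf⟩ := he
  have hue : ∀ o x, height u o (ev e o x) = 0 := comp_eq_zero_iff_height.1 hu.w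
  replace hf : ∀ o y, height u o y < 1 → ∃ x, ev e o x = ev f o y := hf
  obtain ⟨k, hk⟩ := exists_reverse k₀
  have k0 : ∀ o y, hv k o y 0 = y := fun o y => by
    rw [hk, unitInterval.symm_zero]; exact ev_congr hk1 o y
  have k1 : ∀ o y, hv k o y 1 = ev f o y := fun o y => by
    rw [hk, unitInterval.symm_one]; exact ev_congr hk0 o y
  have hkc : ∀ o y, height u o y = 0 → ∀ t, hv k o y t = hv k o y 0 := by
    have hfe : ∀ o x t, hv k₀ o (ev e o x) t = ev f o (ev e o x) := hv_congr hke
    intro o y hy t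
    obtain ⟨x, rfl⟩ := exists_of_height_eq_zero hu hy
    rw [hk, hk, hfe, hfe]
  -- the time at which the deformation is finished
  obtain ⟨u', hu'⟩ := exists_height (Y := Y) (fun o y => clamp (2 * height u o y))
    (fun o => (isTime_height u o).comp (θ := fun t => clamp (2 * t)) (by fun_prop))
    fun g y => by rw [height_act]
  have hu'0 : ∀ o y, height u' o y = 0 → height u o y = 0 := fun o y h => by
    rw [hu'] at h
    have h1 := Set.projIcc_eq_left (zero_lt_one (α := ℝ)) |>.1 h
    exact le_antisymm (Subtype.coe_le_coe.1 (by rw [Set.Icc.coe_zero]; linarith))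
      (height u o y).2.1
  have hu'1 : ∀ o y, ¬ height u o y ≤ clamp (1 / 2) → height u' o y = 1 := fun o y h => by
    rw [hu', clamp_of_one_le]
    have h1 : (clamp (1 / 2) : ℝ) < height u o y := not_le.1 h
    rw [coe_clamp (by norm_num) (by norm_num)] at h1
    linarith
  obtain ⟨D, hD⟩ := exists_slowdown k u' fun o y hy => hkc o y (hu'0 o y hy)
  have hDf : ∀ o y t, height u' o y ≤ t → hv D o y t = ev f o y := by
    intro o y t ht
    rw [hD]
    by_cases ht0 : t = 0
    · subst ht0
      rw [ratio_zero, ← k1, hkc o y (hu'0 o y (le_antisymm ht (height u' o y).2.1)) 1]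
    · rw [ratio_of_le ht ht0, k1]
  obtain ⟨i, hi⟩ := exists_sublevel_incl u (clamp (1 / 2))
  obtain ⟨l, hl⟩ := exists_lift_of_isPullback hu (i ≫ f) fun o
      (z : {y // height u o y ≤ clamp (1 / 2)}) => by
    obtain ⟨x, hx⟩ := hf o z.1 (z.2.trans_lt (Subtype.coe_lt_coe.1 (by
      rw [coe_clamp] <;> norm_num)))
    refine (congrArg (fun y => height u o (ev f o y)) (hi o z.1 z.2)).trans ?_
    exact (congrArg (height u o) hx).symm.trans (hue o x)
  have hl' : ∀ o y hy, ev e o (ev l o (sublevelMk y hy)) = ev f o y := fun o y hy => by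
    rw [hl, ev_comp, hi]
  rw [isHCofibration_iff]
  intro E a h hah
  classical
  -- The last alternative never occurs: `u > 1/2` forces `u' = 1`, which no `t` exceeds.
  obtain ⟨R, hR⟩ := exists_cyl_hom (Y := Y) (Z := E)
    (fun o y t => if t ≤ height u' o y then ev a o (hv D o y t) else
      if hy : height u o y ≤ clamp (1 / 2) then
        hv h o (ev l o (sublevelMk y hy)) (clamp (t - height u' o y)) else ev a o y)
    (fun o => by
      have hut : IsTime (X := CircSpace.cyl (Y.obj o).obj) fun q => height u o q.1 :=
        (isTime_height u o).comp_isStream IsStream.fst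
      have hut' : IsTime (X := CircSpace.cyl (Y.obj o).obj) fun q => height u' o q.1 :=
        (isTime_height u' o).comp_isStream IsStream.fst
      have hd : IsTime (X := CircSpace.cyl (Y.obj o).obj)
          fun q => ((q.2 : unitInterval) : ℝ) - height u' o q.1 :=
        IsTime.snd.comp₂ hut' (θ := fun s t => (s : ℝ) - t) (by fun_prop)
      refine IsStream.of_cover (hd.closedUpper (isClosed_Iic (a := 0)))
        ((hd.comp₂ hut (θ := Prod.mk) continuous_id).closedUpper
          ((isClosed_Ici (a := 0)).prod (isClosed_Iic (a := clamp (1 / 2))))) ?_ ?_ ?_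
      · intro q
        by_cases hq : q.2 ≤ height u' o q.1
        · exact Or.inl ((sub_nonpos (α := ℝ)).2 hq)
        · refine Or.inr ⟨(sub_nonneg (α := ℝ)).2 (not_le.1 hq).le, ?_⟩
          by_contra hq'
          exact hq ((hu'1 o q.1 hq').symm ▸ unitInterval.le_one')
      · convert ((isStream_ev a o).comp (isStream_hv D o)).comp (ClosedUpper.isStream_val _)
          using 2 with q
        exact if_pos ((sub_nonpos (α := ℝ)).1 q.2)
      · have hval := ClosedUpper.isStream_val ((hd.comp₂ hut (θ := Prod.mk)
          continuous_id).closedUpper ((isClosed_Ici (a := 0)).prod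
            (isClosed_Iic (a := clamp (1 / 2)))))
        have hst := (isStream_hv h o).comp (((isStream_ev l o).comp
          (ClosedUpper.isStream_codRestrict
            (C := (isTime_height u o).closedUpper (isClosed_Iic (a := clamp (1 / 2))))
            (IsStream.fst.comp hval) fun q => q.2.2)).prodMk
              ((hd.comp continuous_clamp).comp_isStream hval))
        convert hst using 2 with q
        have hq : height u o q.1.1 ≤ clamp (1 / 2) := q.2.2
        have hq' : height u' o q.1.1 ≤ q.1.2 := (sub_nonneg (α := ℝ)).1 q.2.1
        split_ifs with h1
        · have h2 : q.1.2 = height u' o q.1.1 := le_antisymm h1 hq'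
          rw [hDf _ _ _ hq', ← hl' o _ hq, ← hah]
          congr 1
          rw [h2, sub_self, clamp_zero]
        · rfl)
    fun g y t => by
      simp only [height_act]
      split_ifs with h1 h2
      · rw [hv_act, ev_act]
      · rw [← act_sublevelMk g y h2, ev_act, hv_act]
      · rw [ev_act]
  refine ⟨R, fun o y => ?_, fun o x t => ?_⟩
  · rw [hR, if_pos (unitInterval.nonneg' (t := height u' o y)), hD, ratio_zero, k0]
  · have hx' : height u' o (ev e o x) = 0 := by rw [hu', hue]; simp
    have hx : height u o (ev e o x) ≤ clamp (1 / 2) := by rw [hue]; exact (clamp _).2.1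
    -- Since `f e = e`, the lift of `f` fixes `X` once `e` is known to be injective.
    have hlx : ev l o (sublevelMk _ hx) = x := injective_of_isPullback hu (by
      rw [hl', ← k1, hkc o _ (hue o x), k0])
    rw [hR, hx', dif_pos hx, hlx]
    split_ifs with ht
    · have ht0 : t = 0 := le_antisymm ht t.2.1
      subst ht0
      rw [hD, ratio_zero, k0, hah]
    · simp

end DiagStream

namespace CircSpace

variable {X Y Z : CircSpace.{u}}

/-! ### Final streams -/

section Final

variable {S : Type u} {ι : Type v} {K : ι → CircSpace.{u}} {φ : ∀ i, K i → S}

theorem IsStream.of_final {f : S → Z} (h : ∀ i, IsStream fun a => f (φ i a)) :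
    IsStream (X := finalSpace S K φ) f :=
  (finalDesc f fun i => ⟨(h i).hom, fun _ => rfl⟩).isStream

theorem IsTime.of_final {T : Type*} [TopologicalSpace T] {w : S → T}
    (h : ∀ i, IsTime fun a => w (φ i a)) : IsTime (X := finalSpace S K φ) w := by
  refine ⟨⟨fun A hA => isOpen_finalSpace.2 fun i => hA.preimage (h i).continuous⟩, ?_⟩
  rintro x y ⟨-, hr⟩
  induction hr with
  | refl => rfl
  | tail _ hs ih =>
    obtain ⟨i, a, b, hab, rfl, rfl⟩ := hs
    exact ih.trans ((h i).eq hab)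

theorem isCompactlyFinal_finalSpace (h : ∀ i, (K i).IsCompactlyFinal) :
    (finalSpace S K φ).IsCompactlyFinal := by
  constructor
  · intro A hA
    exact isOpen_finalSpace.2 fun i => (h i).1 _ fun L ψ hL => hA L (ψ ≫ finalMap K φ i) hL
  · rintro U x y ⟨-, hr⟩
    induction hr with
    | refl => exact .refl
    | tail _ hs ih =>
      obtain ⟨i, a, b, hab, rfl, rfl⟩ := hs
      refine ih.trans (((h i).2 _ _ _ hab).lift (φ i) ?_)
      rintro _ _ ⟨L, ψ, c, d, hL, hcd, rfl, rfl⟩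
      exact ⟨L, ψ ≫ finalMap K φ i, c, d, hL, hcd, rfl, rfl⟩

end Final

/-! ### Mapping cylinders -/

/-- The underlying set of the mapping cylinder of a map `X → Y`. -/
abbrev MapCylCarrier (X Y : CircSpace.{u}) : Type u := Y ⊕ X × {t : unitInterval // 0 < t}

open Classical in
/-- The quotient map from `X × 𝕀` to the mapping cylinder. -/
noncomputable def mapCylGlue (f : X ⟶ Y) (p : X × unitInterval) : MapCylCarrier X Y :=
  if h : 0 < p.2 then .inr (p.1, ⟨p.2, h⟩) else .inl (f.map p.1)

/-- The pieces of the mapping cylinder. -/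
def mapCylPiece (X Y : CircSpace.{u}) (b : Bool) : CircSpace.{u} := bif b then cyl X else Y

/-- The structure maps of the mapping cylinder. -/
noncomputable def mapCylIncl (f : X ⟶ Y) : ∀ b, mapCylPiece X Y b → MapCylCarrier X Y
  | false => Sum.inl
  | true => mapCylGlue f

/-- The mapping cylinder `Y ∪ X × 𝕀`, with `(x, 0)` identified with `f x`. -/
noncomputable def mapCyl (f : X ⟶ Y) : CircSpace.{u} :=
  finalSpace (MapCylCarrier X Y) (mapCylPiece X Y) (mapCylIncl f)

namespace mapCyl

variable {f : X ⟶ Y}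

theorem glue_zero (x : X) : mapCylGlue f (x, 0) = .inl (f.map x) := dif_neg (lt_irrefl _)

theorem glue_pos (x : X) {t : unitInterval} (ht : 0 < t) :
    mapCylGlue f (x, t) = .inr (x, ⟨t, ht⟩) := dif_pos ht

theorem isStream_inl : IsStream (Y := mapCyl f) (Sum.inl : Y → MapCylCarrier X Y) :=
  (finalMap (mapCylPiece X Y) (mapCylIncl f) false).isStream

theorem isStream_glue : IsStream (X := cyl X) (Y := mapCyl f) (mapCylGlue f) :=
  (finalMap (mapCylPiece X Y) (mapCylIncl f) true).isStream

theorem isStream_desc {g : MapCylCarrier X Y → Z} (h : IsStream fun y => g (.inl y))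
    (h' : IsStream (X := cyl X) fun p => g (mapCylGlue f p)) : IsStream (X := mapCyl f) g :=
  IsStream.of_final (by rintro (_ | _); exacts [h, h'])

/-- The projection to the base. -/
def base (f : X ⟶ Y) : MapCylCarrier X Y → Y := Sum.elim id fun p => f.map p.1

/-- The projection to the interval. -/
def level : MapCylCarrier X Y → unitInterval := Sum.elim (fun _ => 0) fun p => p.2.1

theorem base_glue (p : X × unitInterval) : base f (mapCylGlue f p) = f.map p.1 := by
  unfold mapCylGlue
  split_ifs <;> rfl

theorem level_glue (p : X × unitInterval) : level (mapCylGlue f p) = p.2 := by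
  unfold mapCylGlue
  split_ifs with h
  · rfl
  · exact le_antisymm unitInterval.nonneg' (not_lt.1 h)

theorem isStream_base : IsStream (X := mapCyl f) (base f) :=
  isStream_desc IsStream.id (by
    convert f.isStream.comp IsStream.fst using 2 with p
    exact base_glue p)

theorem isTime_level : IsTime (X := mapCyl f) level := by
  refine IsTime.of_final ?_
  rintro (_ | _)
  · exact ⟨continuous_const, fun _ => rfl⟩
  · refine (?_ : IsTime (X := cyl X) fun p => level (mapCylGlue f p))
    convert IsTime.snd (X := X) using 2 with p
    exact level_glue p

/-- The part of the mapping cylinder over an open set of `X`. -/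
def openPart (f : X ⟶ Y) (U : Opens X) : Opens (mapCyl f) :=
  ⟨{m | ∃ x ∈ U, ∃ t, m = Sum.inr (x, t)}, by
    refine isOpen_finalSpace.2 ?_
    rintro (_ | _)
    · convert isOpen_empty
      refine Set.eq_empty_of_forall_notMem ?_
      rintro y ⟨x, -, t, h⟩
      exact Sum.inl_ne_inr h
    · have h : IsOpen {p : X × unitInterval | p.1 ∈ U ∧ (0 : unitInterval) < p.2} :=
        (U.2.preimage continuous_fst).inter ((isOpen_Ioi (a := (0 : unitInterval))).preimage continuous_snd)
      have h' : mapCylGlue f ⁻¹' {m | ∃ x ∈ U, ∃ t, m = Sum.inr (x, t)} =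
          {p : X × unitInterval | p.1 ∈ U ∧ (0 : unitInterval) < p.2} := by
        ext p
        refine ⟨?_, ?_⟩
        · rintro ⟨x, hx, t, h⟩
          unfold mapCylGlue at h
          split_ifs at h with h'
          obtain rfl : p.1 = x := congrArg Prod.fst (Sum.inr.inj h)
          exact ⟨hx, h'⟩
        · rintro ⟨hx, h'⟩
          exact ⟨p.1, hx, ⟨p.2, h'⟩, dif_pos h'⟩
      rw [← h'] at h
      exact h⟩

/-- A generating relation starting at positive level cannot come from `Y`, and one from `X × 𝕀`
keeps the level fixed. The slice of the open part at a positive level is exactly `U`, so each step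
is a relation of `X` in `U`. -/
theorem le_openPart {U : Opens X} {x : X} {t} {m : mapCyl f}
    (h : (mapCyl f).circ.le (openPart f U) (Sum.inr (x, t) : MapCylCarrier X Y) m) :
    ∃ x' t', m = (Sum.inr (x', t') : MapCylCarrier X Y) ∧ X.circ.le U x x' := by
  obtain ⟨⟨_, hx, _, he⟩, hr⟩ := h
  obtain rfl : x = _ := congrArg Prod.fst (Sum.inr.inj he)
  induction hr with
  | refl => exact ⟨x, t, rfl, X.circ.refl hx⟩
  | tail _ hs ih =>
    obtain ⟨a, s, rfl, ha⟩ := ih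
    obtain ⟨_ | _, p, q, hpq, hp, rfl⟩ := hs
    · exact absurd hp Sum.inl_ne_inr
    · obtain ⟨p, r⟩ := (p : X × unitInterval)
      obtain ⟨q, r'⟩ := (q : X × unitInterval)
      obtain ⟨hrr, hpq⟩ := hpq
      obtain rfl : r = r' := hrr
      have hp' : mapCylGlue f (p, r) = Sum.inr (a, s) := hp
      have hr0 : 0 < r := by
        by_contra h0
        rw [mapCylGlue, dif_neg h0] at hp'
        exact Sum.inl_ne_inr hp'
      rw [glue_pos p hr0] at hp'
      obtain rfl : p = a := congrArg Prod.fst (Sum.inr.inj hp')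
      refine ⟨q, ⟨r, hr0⟩, glue_pos q hr0, X.circ.trans ha (X.circ.mono ?_ hpq)⟩
      rintro z ⟨z', hz', t', h'⟩
      have h'' := (glue_pos (f := f) z hr0).symm.trans h'
      obtain rfl : z = z' := congrArg Prod.fst (Sum.inr.inj h'')
      exact hz'

theorem continuous_of_inr {T : Type*} [TopologicalSpace T] {g : T → mapCyl f} (hg : Continuous g)
    {v : T → X} (hv : ∀ z, ∃ t, g z = (Sum.inr (v z, t) : MapCylCarrier X Y)) : Continuous v := by
  refine ⟨fun U hU => ?_⟩
  convert (openPart f ⟨U, hU⟩).2.preimage hg using 1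
  ext z
  obtain ⟨t, ht⟩ := hv z
  refine ⟨fun h => ⟨v z, h, t, ht⟩, ?_⟩
  rintro ⟨x, hx, t', h'⟩
  rw [ht] at h'
  have h2 : v z = x := congrArg Prod.fst (Sum.inr.inj h')
  change v z ∈ U
  rw [h2]
  exact hx

/-- The open parts recover both topology and circulation of `X`. This makes lifts into `X` stream
maps, not just functions. -/
theorem isStream_of_inr {g : Z → mapCyl f} (hg : IsStream g) {v : Z → X}
    (hv : ∀ z, ∃ t, g z = (Sum.inr (v z, t) : MapCylCarrier X Y)) : IsStream v := by
  refine ⟨continuous_of_inr hg.continuous hv, fun {V U x y} hxy hV => ?_⟩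
  obtain ⟨t, ht⟩ := hv x
  obtain ⟨t', ht'⟩ := hv y
  have h := hg.mono (U := openPart f U) hxy fun z hz => by
    obtain ⟨s, hs⟩ := hv z
    exact ⟨v z, hV z hz, s, hs⟩
  rw [ht] at h
  obtain ⟨x', s, hs, hx'⟩ := le_openPart h
  rw [ht'] at hs
  obtain rfl : v y = x' := congrArg Prod.fst (Sum.inr.inj hs)
  exact hx'

theorem isCompactlyFinal (hX : X.IsCompactlyFinal) (hY : Y.IsCompactlyFinal) :
    (mapCyl f).IsCompactlyFinal :=
  isCompactlyFinal_finalSpace (by rintro (_ | _); exacts [hY, hX.cyl])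

/-- Points of the image of `K` with different levels or bases are separated by those functions. What
remains is two points of the same positive level `t` with different `X`-coordinates. For `0 < s < t`
the part of `K` of level at least `s` is compact and its `X`-coordinate is continuous, so the two
points can be separated in its image in `X`. -/
theorem isWeakHausdorff (hX : IsWeakHausdorff X) (hY : IsWeakHausdorff Y) :
    IsWeakHausdorff (mapCyl f) := by
  intro K _ _ _ φ
  refine ⟨?_⟩
  rintro ⟨m, hm⟩ ⟨m', hm'⟩ hne
  have hle : Continuous fun q : Set.range φ => level (X := X) (Y := Y) q.1 :=
    (isTime_level (f := f)).continuous.comp continuous_subtype_val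
  by_cases hl : level (X := X) (Y := Y) m = level (X := X) (Y := Y) m'
  swap
  · exact separated_by_continuous hle hl
  by_cases hb : base f m = base f m'
  swap
  · have := hY K ⟨fun k => base f (φ k), (isStream_base (f := f)).continuous.comp φ.continuous⟩
    refine separated_by_continuous (f := fun q : Set.range φ =>
      (⟨base f q.1, by obtain ⟨_, k, rfl⟩ := q; exact ⟨k, rfl⟩⟩ :
        Set.range fun k => base f (φ k))) ?_ fun h => hb (congrArg Subtype.val h)
    exact ((isStream_base (f := f)).continuous.comp continuous_subtype_val).subtype_mk _
  obtain y | ⟨x, t⟩ := (m : MapCylCarrier X Y)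
  · obtain y' | ⟨x', t'⟩ := (m' : MapCylCarrier X Y)
    · exact absurd (Subtype.ext (congrArg Sum.inl hb)) hne
    · exact absurd hl t'.2.ne
  obtain y' | ⟨x', t'⟩ := (m' : MapCylCarrier X Y)
  · exact absurd hl t.2.ne'
  obtain rfl : t = t' := Subtype.ext hl
  have hxx : x ≠ x' := by
    rintro rfl
    exact hne rfl
  obtain ⟨s, hs0, hst⟩ := exists_between t.2
  let C : Set K := {k | s ≤ level (X := X) (Y := Y) (φ k)}
  have hφl : Continuous fun k => level (X := X) (Y := Y) (φ k) :=
    (isTime_level (f := f)).continuous.comp φ.continuous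
  have hC : IsClosed C := isClosed_le continuous_const hφl
  have : CompactSpace C := isCompact_iff_compactSpace.1 hC.isCompact
  have hv : ∀ k : C, ∃ x, ∃ t, φ k = (Sum.inr (x, t) : MapCylCarrier X Y) := by
    rintro ⟨k, hk⟩
    change s ≤ level (X := X) (Y := Y) (φ k) at hk
    change ∃ x t, φ k = (Sum.inr (x, t) : MapCylCarrier X Y)
    generalize φ k = m at hk ⊢
    obtain y | ⟨x, t⟩ := (m : MapCylCarrier X Y)
    · exact absurd (hs0.trans_le hk) (lt_irrefl _)
    · exact ⟨x, t, rfl⟩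
  choose v hv using hv
  have hvc : Continuous v :=
    continuous_of_inr (φ.continuous.comp continuous_subtype_val) hv
  have hvr : ∀ k (z : X) (r), s ≤ r.1 → φ k = (Sum.inr (z, r) : MapCylCarrier X Y) →
      ∃ c : C, v c = z ∧ c.1 = k := by
    intro k z r hr hk
    have hkC : k ∈ C := by
      change s ≤ level (X := X) (Y := Y) (φ k)
      rw [hk]
      exact hr
    obtain ⟨t', ht'⟩ := hv ⟨k, hkC⟩
    exact ⟨⟨k, hkC⟩, congrArg Prod.fst (Sum.inr.inj (ht'.symm.trans hk)), rfl⟩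
  have hT := hX C ⟨v, hvc⟩
  obtain ⟨k, hk⟩ := hm
  obtain ⟨k', hk'⟩ := hm'
  obtain ⟨c, hc, -⟩ := hvr k x t hst.le hk
  obtain ⟨c', hc', -⟩ := hvr k' x' t hst.le hk'
  obtain ⟨A, A', hA, hA', hxA, hxA', hAA⟩ := t2_separation (X := Set.range v)
    (x := ⟨x, c, hc⟩) (y := ⟨x', c', hc'⟩) fun h => hxx (congrArg Subtype.val h)
  obtain ⟨U, hU, rfl⟩ := isOpen_induced_iff.1 hA
  obtain ⟨U', hU', rfl⟩ := isOpen_induced_iff.1 hA'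
  have hlt : IsOpen {q : Set.range φ | s < level (X := X) (Y := Y) q.1} :=
    isOpen_lt continuous_const hle
  -- Restricting one of the two open sets to levels above `s` suffices: a common point then has its
  -- `X`-coordinate in the Hausdorff image.
  refine ⟨_, _, ((openPart f ⟨U, hU⟩).2.preimage continuous_subtype_val).inter hlt,
    (openPart f ⟨U', hU'⟩).2.preimage continuous_subtype_val, ⟨⟨x, hxA, t, rfl⟩, hst⟩,
    ⟨x', hxA', t, rfl⟩, ?_⟩
  rw [Set.disjoint_left]
  rintro ⟨_, j, rfl⟩ ⟨⟨z, hz, r, hr⟩, hs⟩ ⟨z', hz', r', hr'⟩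
  obtain rfl : z = z' := congrArg Prod.fst (Sum.inr.inj (hr.symm.trans hr'))
  have hs' : s < r.1 := by
    change s < level (X := X) (Y := Y) (φ j) at hs
    change φ j = (Sum.inr (z, r) : MapCylCarrier X Y) at hr
    rw [hr] at hs
    exact hs
  obtain ⟨d, hd, -⟩ := hvr j z r hs'.le hr
  have hd' := Set.disjoint_left.1 hAA
  exact @hd' ⟨z, d, hd⟩ hz hz'

end mapCyl

/-- Two paths in a weak Hausdorff stream that agree at positive times agree at time `0`. -/
theorem IsWeakHausdorff.path_eq (h : IsWeakHausdorff Y) {γ γ' : unitInterval → Y}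
    (hγ : Continuous γ) (hγ' : Continuous γ') (he : ∀ t, 0 < t → γ t = γ' t) : γ 0 = γ' 0 := by
  -- Both paths are combined into one map from a compact Hausdorff space, so that their images lie
  -- in a single Hausdorff subspace.
  let φ : C(ULift.{u} unitInterval ⊕ ULift.{u} unitInterval, Y) :=
    ⟨Sum.elim (fun t => γ t.down) fun t => γ' t.down,
      (hγ.comp continuous_uliftDown).sumElim (hγ'.comp continuous_uliftDown)⟩
  have := h _ φ
  let δ : unitInterval → Set.range φ := fun t => ⟨γ t, .inl ⟨t⟩, rfl⟩
  let δ' : unitInterval → Set.range φ := fun t => ⟨γ' t, .inr ⟨t⟩, rfl⟩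
  have hδ : Continuous δ := hγ.subtype_mk _
  have hδ' : Continuous δ' := hγ'.subtype_mk _
  have hd : Dense {t : unitInterval | 0 < t} := by
    have : (Set.Ioi (0 : unitInterval)) = {0}ᶜ := by
      ext t
      exact unitInterval.pos_iff_ne_zero
    change Dense (Set.Ioi (0 : unitInterval))
    rw [this]
    exact dense_compl_singleton 0
  have := hδ.ext_on hd hδ' fun t ht => Subtype.ext (he t ht)
  exact congrArg Subtype.val (congrFun this 0)

end CircSpace

namespace DiagStream

open CircSpace

variable {G : Type u} [SmallCategory G] {X Y Z : G ⥤ KStream.{u}}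

/-! ### Cofibrations are neighborhood deformation retracts -/

/-- The action of the diagrams on a mapping cylinder. -/
def mapCylAct (X Y : G ⥤ KStream.{u}) {o o' : G} (g : o ⟶ o') :
    MapCylCarrier (X.obj o).obj (Y.obj o).obj → MapCylCarrier (X.obj o').obj (Y.obj o').obj :=
  Sum.map (act Y g) (Prod.map (act X g) id)

theorem mapCylAct_glue (e : X ⟶ Y) {o o' : G} (g : o ⟶ o') (p : X.obj o × unitInterval) :
    mapCylAct X Y g (mapCylGlue (e.app o).hom p) =
      mapCylGlue (e.app o').hom (act X g p.1, p.2) := by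
  unfold mapCylGlue
  split_ifs with h
  · rfl
  · exact congrArg Sum.inl (ev_act e g p.1).symm

/-- The mapping cylinder of a map of diagrams. -/
noncomputable def mapCyl (e : X ⟶ Y) : G ⥤ KStream.{u} where
  obj o := ⟨CircSpace.mapCyl (e.app o).hom,
    (CircSpace.mapCyl.isCompactlyFinal (X.obj o).property.1.isCompactlyFinal
      (Y.obj o).property.1.isCompactlyFinal).isKStream,
    CircSpace.mapCyl.isWeakHausdorff (X.obj o).property.2 (Y.obj o).property.2⟩
  map {o o'} g := ObjectProperty.homMk (IsStream.hom (f := mapCylAct X Y g)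
    (CircSpace.mapCyl.isStream_desc (Z := CircSpace.mapCyl (e.app o').hom)
      (CircSpace.mapCyl.isStream_inl.comp (isStream_act Y g)) (by
        have h := CircSpace.mapCyl.isStream_glue (f := (e.app o').hom) |>.comp
          (((isStream_act X g).comp IsStream.fst).prodMk IsTime.snd)
        exact h.congr (mapCylAct_glue e g))))
  map_id o := ObjectProperty.hom_ext _ (CircSpace.hom_ext (by
    rintro (y | ⟨x, t⟩)
    · exact congrArg Sum.inl (act_id Y o y)
    · exact congrArg (fun z => Sum.inr (z, t)) (act_id X o x)))
  map_comp g g' := ObjectProperty.hom_ext _ (CircSpace.hom_ext (by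
    rintro (y | ⟨x, t⟩)
    · exact congrArg Sum.inl (act_comp Y g g' y)
    · exact congrArg (fun z => Sum.inr (z, t)) (act_comp X g g' x)))

/-- The base `q` of `r` deforms `Y`, fixing `X`, and lies in the image of `e` wherever the level `ℓ`
is positive. On `X` level equals time, so the largest excess of time over level vanishes there. It
is below `1` only if `ℓ (y, 1) > 0`, which puts `q (y, 1)` in the image. -/
theorem isNDR_of_retraction {e : X ⟶ Y} (r : cyl Y ⟶ mapCyl e)
    (r0 : ∀ o y, hv r o y 0 = (Sum.inl y : MapCylCarrier (X.obj o).obj (Y.obj o).obj))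
    (hr : ∀ o x t, hv r o (ev e o x) t = mapCylGlue (e.app o).hom (x, t)) : IsNDR e := by
  let q : ∀ o, Y.obj o → unitInterval → Y.obj o := fun o y t =>
    mapCyl.base (e.app o).hom (hv r o y t)
  let ℓ : ∀ o, Y.obj o → unitInterval → unitInterval := fun o y t =>
    mapCyl.level (X := (X.obj o).obj) (Y := (Y.obj o).obj) (hv r o y t)
  have hq : ∀ o, IsStream (X := CircSpace.cyl (Y.obj o).obj) (Y := (Y.obj o).obj)
      fun p => q o p.1 p.2 := fun o => mapCyl.isStream_base.comp (isStream_hv r o)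
  have hℓ : ∀ o, IsTime (X := CircSpace.cyl (Y.obj o).obj) fun p => ℓ o p.1 p.2 := fun o =>
    (mapCyl.isTime_level (f := (e.app o).hom)).comp_isStream (isStream_hv r o)
  have q0 : ∀ o y, q o y 0 = y := fun o y => congrArg (mapCyl.base (e.app o).hom) (r0 o y)
  have hqe : ∀ o x t, q o (ev e o x) t = ev e o x := fun o x t =>
    (congrArg (mapCyl.base (e.app o).hom) (hr o x t)).trans (mapCyl.base_glue _)
  have hℓe : ∀ o x t, ℓ o (ev e o x) t = t := fun o x t =>
    (congrArg mapCyl.level (hr o x t)).trans (mapCyl.level_glue (f := (e.app o).hom) _)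
  have hpos : ∀ o y t, 0 < ℓ o y t →
      ∃ x s, hv r o y t = (Sum.inr (x, s) : MapCylCarrier (X.obj o).obj (Y.obj o).obj) := by
    intro o y t h
    change 0 < mapCyl.level (X := (X.obj o).obj) (Y := (Y.obj o).obj) (hv r o y t) at h
    generalize hv r o y t = m at h ⊢
    obtain y | ⟨x, s⟩ := (m : MapCylCarrier (X.obj o).obj (Y.obj o).obj)
    · exact absurd h (lt_irrefl _)
    · exact ⟨x, s, rfl⟩
  have hpos' : ∀ o y t, 0 < ℓ o y t → ∃ x, ev e o x = q o y t := by
    intro o y t h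
    obtain ⟨x, s, hx⟩ := hpos o y t h
    exact ⟨x, (congrArg (mapCyl.base (e.app o).hom) hx).symm⟩
  have hact : ∀ {o o'} (g : o ⟶ o') (y : Y.obj o) t, q o' (act Y g y) t = act Y g (q o y t) ∧
      ℓ o' (act Y g y) t = ℓ o y t := by
    intro o o' g y t
    have h := hv_act r g y t
    simp only [q, ℓ, h]
    generalize hv r o y t = m
    obtain y | ⟨x, s⟩ := (m : MapCylCarrier (X.obj o).obj (Y.obj o).obj)
    · exact ⟨rfl, rfl⟩
    · exact ⟨ev_act e g x, rfl⟩
  -- the deviation of the level from the time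
  let d : ∀ o, Y.obj o → unitInterval → unitInterval := fun o y t => clamp ((t : ℝ) - ℓ o y t)
  have hd : ∀ o, IsTime (X := CircSpace.cyl (Y.obj o).obj) fun p => d o p.1 p.2 := fun o =>
    IsTime.snd.comp₂ (hℓ o) (θ := fun s t => clamp ((s : ℝ) - t)) (by fun_prop)
  -- The supremum is continuous by compactness of `𝕀`. Taken over all times, it vanishes only if
  -- level never falls behind time; the deviation at time `1` alone would not control small times.
  obtain ⟨u, hu⟩ := exists_height (Y := Y) (fun o y => ⨆ t, d o y t)
    (fun o => by
      refine ⟨?_, fun {y y'} h => iSup_congr fun t =>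
        ((hd o).comp_isStream (IsStream.slice t)).eq h⟩
      have h := isCompact_univ.continuous_sSup (f := d o) (hd o).continuous
      exact h.congr fun y => by rw [Set.image_univ, sSup_range])
    fun g y => by simp only [d, (hact g y _).2]
  have hdu : ∀ o y t, d o y t ≤ height u o y := fun o y t => by
    rw [hu]
    exact le_ciSup (f := d o y) ⟨1, by rintro _ ⟨_, rfl⟩; exact unitInterval.le_one'⟩ t
  have hue : ∀ o x, height u o (ev e o x) = 0 := fun o x => by
    rw [hu]
    simp only [d, hℓe, sub_self, clamp_zero, ciSup_const]
  have hu1 : ∀ o y, height u o y < 1 → 0 < ℓ o y 1 := by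
    intro o y h
    by_contra h0
    have h0' : ℓ o y 1 = 0 := le_antisymm (not_lt.1 h0) unitInterval.nonneg'
    have h1 : d o y 1 = 1 := by simp [d, h0']
    exact absurd ((hdu o y 1).trans_lt h) (by rw [h1]; exact lt_irrefl _)
  have hu0 : ∀ o y, height u o y = 0 → ∀ t, t ≤ ℓ o y t := by
    intro o y h t
    have h1 : d o y t = 0 := le_antisymm ((hdu o y t).trans h.le) unitInterval.nonneg'
    have h2 := (Set.projIcc_eq_left (zero_lt_one (α := ℝ))).1 h1
    exact Subtype.coe_le_coe.1 (by linarith)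
  -- points of height zero are in the image
  have hlift : ∀ o y, height u o y = 0 → ∃ x s,
      hv r o y 1 = (Sum.inr (x, s) : MapCylCarrier (X.obj o).obj (Y.obj o).obj) ∧
        ev e o x = y := by
    intro o y h
    have hle := hu0 o y h
    obtain ⟨x, s, hx⟩ := hpos o y 1 (zero_lt_one.trans_le (hle 1))
    refine ⟨x, s, hx, ?_⟩
    -- For `t > 0` the point `q (y, t)` lies in the image of `e`, so `q (-, 1)` fixes it. Weak
    -- Hausdorffness extends this to `t = 0`, where it says `q (y, 1) = y`.
    have hγ : Continuous fun t => q o y t := 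
      (hq o).continuous.comp (Continuous.prodMk_right y)
    have hγ' : Continuous fun t => q o (q o y t) 1 :=
      ((hq o).comp (IsStream.slice 1)).continuous.comp hγ
    have h1 := (Y.obj o).property.2.path_eq hγ' hγ fun t ht => by
      obtain ⟨z, hz⟩ := hpos' o y t (ht.trans_le (hle t))
      rw [← hz, hqe]
    rw [q0] at h1
    rw [← h1]
    exact (congrArg (mapCyl.base (e.app o).hom) hx).symm
  have hinj : ∀ o (x x' : X.obj o), ev e o x = ev e o x' → x = x' := by
    intro o x x' h
    have h1 : mapCylGlue (e.app o).hom (x, 1) = mapCylGlue (e.app o).hom (x', 1) := by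
      rw [← hr, ← hr, h]
    rw [mapCyl.glue_pos x zero_lt_one, mapCyl.glue_pos x' zero_lt_one] at h1
    exact congrArg Prod.fst (Sum.inr.inj h1)
  obtain ⟨k, hk⟩ := exists_cyl_hom (Y := Y) (Z := Y) q hq fun g y t => (hact g y t).1
  -- `k` leads from the identity to `f`, while the definition asks for a homotopy from `f` to the
  -- identity.
  obtain ⟨k', hk'⟩ := exists_reverse k
  -- The lift is the `X`-coordinate of `r (f z, 1)`, a stream map because the level there is
  -- positive. Injectivity of `e` makes it natural.
  have hfac : ∀ {Z : G ⥤ KStream.{u}} (f : Z ⟶ Y), f ≫ u = toPoint Z ≫ zero G →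
      ∃ l : Z ⟶ X, l ≫ e = f := by
    intro Z f hf
    replace hf := comp_eq_zero_iff_height.1 hf
    choose v s hv hve using fun o z => hlift o (ev f o z) (hf o z)
    obtain ⟨l, hl⟩ := exists_hom v
      (fun o => mapCyl.isStream_of_inr
        (((isStream_hv r o).comp (IsStream.slice 1)).comp (isStream_ev f o))
        fun z => ⟨s o z, hv o z⟩)
      fun g z => hinj _ _ _ (by rw [hve, ev_act, ev_act, hve])
    exact ⟨l, ext_ev fun o z => by rw [ev_comp, hl, hve]⟩
  have hmono : ∀ {Z : G ⥤ KStream.{u}} {l l' : Z ⟶ X}, l ≫ e = l' ≫ e → l = l' := fun h =>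
    ext_ev fun o z => hinj o _ _ (ev_congr h o z)
  have hw : e ≫ u = toPoint X ≫ zero G := comp_eq_zero_iff_height.2 hue
  have hpb : IsPullback e (toPoint X) u (zero G) := by
    refine ⟨⟨hw⟩, ⟨PullbackCone.IsLimit.mk hw
      (fun s => (hfac s.fst s.condition).choose)
      (fun s => (hfac s.fst s.condition).choose_spec) (fun s => ext_ev fun _ _ => rfl)
      fun s m hm _ => hmono (hm.trans (hfac s.fst s.condition).choose_spec.symm)⟩⟩
  refine ⟨u, hpb, cylIncl 1 Y ≫ k, ⟨ext_ev fun o x => ?_, k',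
    ⟨ext_ev fun o y => ?_, ext_ev fun o y => ?_⟩, ext_hv fun o x t => ?_⟩, fun o y hy => ?_⟩
  · rw [ev_comp, ev_comp, ev_cylIncl, hk, hqe, ev_comp, ev_id]
  · rw [ev_comp, ev_comp, ev_cylIncl, ev_cylIncl, hk', unitInterval.symm_zero]
  · rw [ev_comp, ev_cylIncl, hk', unitInterval.symm_one, hk, q0, ev_id]
  · rw [hv_cylMap, hv_cylProj, hk', hk, hqe, ev_comp, ev_comp, ev_cylIncl, hk, hqe]
  · obtain ⟨x, hx⟩ := hpos' o y 1 (hu1 o y hy)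
    exact ⟨x, hx.trans (hk o y 1).symm⟩

/-- The mapping cylinder carries the universal homotopy extension problem for `e`; its solution is
the map `r` of `isNDR_of_retraction`. -/
theorem IsHCofibration.isNDR {e : X ⟶ Y} (he : IsHCofibration e) : IsNDR e := by
  obtain ⟨a, ha⟩ := exists_hom (Y := Y) (Z := mapCyl e)
    (fun o y => (Sum.inl y : MapCylCarrier (X.obj o).obj (Y.obj o).obj))
    (fun o => CircSpace.mapCyl.isStream_inl) fun _ _ => rfl
  obtain ⟨h, hh⟩ := exists_cyl_hom (Y := X) (Z := mapCyl e)
    (fun o x t => mapCylGlue (e.app o).hom (x, t)) (fun o => CircSpace.mapCyl.isStream_glue)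
    fun g x t => (mapCylAct_glue e g (x, t)).symm
  obtain ⟨r, r0, hr⟩ := (isHCofibration_iff e).1 he _ a h fun o x => by
    rw [hh, ha]
    exact CircSpace.mapCyl.glue_zero x
  exact isNDR_of_retraction r (fun o y => (r0 o y).trans (ha o y))
    fun o x t => (hr o x t).trans (hh o x t)

end DiagStream

/-! ### The equivalence of the three conditions -/

theorem mainTheorem2 {G : Type u} [SmallCategory G] {X Y : G ⥤ KStream.{u}} (e : X ⟶ Y) :
    [ ∀ {E B : G ⥤ KStream.{u}} (p : E ⟶ B), DiagStream.IsHAcyclic p →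
        DiagStream.IsHFibration p → HasLiftingProperty e p,
      DiagStream.IsHCofibration e,
      DiagStream.IsNDR e ].TFAE := by
  tfae_have 1 → 2 := fun h E =>
    h _ (DiagStream.isHAcyclic_pathEval E) (DiagStream.isHFibration_pathEval E)
  tfae_have 2 → 3 := DiagStream.IsHCofibration.isNDR
  tfae_have 3 → 2 := DiagStream.IsNDR.isHCofibration
  -- The lifting argument needs a function with zero set `X`, so it passes through condition 3.
  tfae_have 2 → 1 := fun h E B p ha hf => by
    obtain ⟨u, hu, -⟩ := h.isNDR
    exact h.hasLiftingProperty u (DiagStream.comp_eq_zero_iff_height.1 hu.w)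
      (fun o y hy => DiagStream.exists_of_height_eq_zero hu hy) hf ha
  tfae_finish
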